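/- **Proposition 2.** Let $\mathbb V=\mathbb R^n$ or $\mathbb V=\mathbb C^n$. Let $A_1,\dots,A_m$ be symmetric (respectively hermitian) $n\times n$ matrices, $v_1,\dots,v_m\in\mathbb V$, $f^0\in\mathbb R^m$, and let $f:\mathbb V\to\mathbb R^m$ be the quadratic map $f_i(x)=x^*A_ix-v_i^*x-x^*v_i+f^0_i$. For $c\in\mathbb R^m$ write $c\cdot A=\sum_i c_iA_i$, and similarly $c\cdot v=\sum_i c_iv_i$. Let $c_+\in\mathbb R^m\setminus\{0\}$ be such that $A_+:=c_+\cdot A$ is positive definite; put $|x|_+^2:=x^*A_+x$ and $x_0:=A_+^{-1}(c_+\cdot v)$. Let $\lambda^+_{\min}(M)$ be the smallest generalized eigenvalue of $M$ with respect to $A_+$, i.e. the smallest $\lambda\in\mathbb R$ such that $(M-\lambda A_+)x=0$ for some $x\neq0$. Define $z_{\max}\in[0,\infty]$ by $$z_{\max}:=\limsup_{\epsilon\to0^+}\ \min_{c\in\mathcal C}\left|\left(c\cdot A-\lambda^+_{\min}(c\cdot A)A_++\epsilon I\right)^{-1}c\cdot(v-Ax_0)\right|_+^2,\qquad \mathcal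 C=\{c\in\mathbb R^m:\ |c|^2=1,\ c\cdot c_+=0\},$$ which is the limit as $\epsilon\to0^+$ whenever that limit exists; here $c\cdot(v-Ax_0)=\sum_i c_i(v_i-A_ix_0)$, and the minimum is $\infty$ if $\mathcal C$ is empty (i.e. $m=1$). Assume $\dim_{\mathbb R}\mathbb V\neq m-1$. Then: 1. the set $\mathscr F(f,c_+,z_{\max})=\{f(x):x\in\mathbb V,\ |x-x_0|_+^2\le z_{\max}\}$ is convex; 2. if $z_{\max}<\infty$, this set is compact, and it is the part of the image cut off by a hyperplane orthogonal to $c_+$: $\mathscr F(f,c_+,z_{\max})=f(\mathbb V)\cap\{y\in\mathbb R^m: c_+\cdot y\le c_+\cdot f(x_0)+z_{\max}\}$; 3. if $z_{\max}=\infty$, the whole image $f(\mathbb V)$ is convex. -/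

import Mathlib

open scoped ComplexOrder ENNReal Topology Matrix

noncomputable section

namespace QuadMap

variable {𝕜 : Type*} [RCLike 𝕜] {m n : ℕ}

/-- The combination `c · A = ∑ i, c i • A i` of an `m`-tuple of matrices. -/
def combMat (c : Fin m → ℝ) (A : Fin m → Matrix (Fin n) (Fin n) 𝕜) : Matrix (Fin n) (Fin n) 𝕜 :=
  ∑ i, (c i : 𝕜) • A i

/-- The combination `c · v = ∑ i, c i • v i` of an `m`-tuple of vectors. -/
def combVec (c : Fin m → ℝ) (v : Fin m → Fin n → 𝕜) : Fin n → 𝕜 :=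
  ∑ i, (c i : 𝕜) • v i

/-- The quadratic map `f i x = x^* (A i) x - (v i)^* x - x^* (v i) + f0 i`. For hermitian `A i` this
number is real, so that taking the real part only changes its type. -/
def quadMap (A : Fin m → Matrix (Fin n) (Fin n) 𝕜) (v : Fin m → Fin n → 𝕜) (f0 : Fin m → ℝ)
    (x : Fin n → 𝕜) : Fin m → ℝ :=
  fun i => RCLike.re (star x ⬝ᵥ (A i *ᵥ x) - star (v i) ⬝ᵥ x - star x ⬝ᵥ v i) + f0 i

/-- The squared norm `|x|_P ^ 2 = x^* P x` given by a positive definite matrix `P`. -/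
def normSqOf (P : Matrix (Fin n) (Fin n) 𝕜) (x : Fin n → 𝕜) : ℝ :=
  RCLike.re (star x ⬝ᵥ (P *ᵥ x))

/-- The smallest generalized eigenvalue of `M` with respect to `P`: the least real `l` for which
`(M - l P) x = 0` has a solution `x ≠ 0`. -/
def minGenEig (P M : Matrix (Fin n) (Fin n) 𝕜) : ℝ :=
  sInf {l : ℝ | ∃ x : Fin n → 𝕜, x ≠ 0 ∧ (M - (l : 𝕜) • P) *ᵥ x = 0}

/-- The point `x₀ = (c₊ · A)⁻¹ (c₊ · v)`. -/
def basePoint (A : Fin m → Matrix (Fin n) (Fin n) 𝕜) (v : Fin m → Fin n → 𝕜) (cp : Fin m → ℝ) :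
    Fin n → 𝕜 :=
  (combMat cp A)⁻¹ *ᵥ combVec cp v

/-- The minimized quantity
`|(c · A - λ⁺_min(c · A) A₊ + ε)⁻¹ c · (v - A x₀)|₊ ^ 2`, where `A₊ = c₊ · A`. -/
def objective (A : Fin m → Matrix (Fin n) (Fin n) 𝕜) (v : Fin m → Fin n → 𝕜) (cp : Fin m → ℝ)
    (ε : ℝ) (c : Fin m → ℝ) : ℝ :=
  normSqOf (combMat cp A)
    ((combMat c A - (minGenEig (combMat cp A) (combMat c A) : 𝕜) • combMat cp A
        + (ε : 𝕜) • (1 : Matrix (Fin n) (Fin n) 𝕜))⁻¹ *ᵥ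
      combVec c (fun i => v i - A i *ᵥ basePoint A v cp))

/-- The minimum of `objective` over the unit vectors `c` orthogonal to `c₊`, in `[0, ∞]`
(it is `∞` if there are no such vectors, that is, if `m = 1`). -/
def minObjective (A : Fin m → Matrix (Fin n) (Fin n) 𝕜) (v : Fin m → Fin n → 𝕜)
    (cp : Fin m → ℝ) (ε : ℝ) : ℝ≥0∞ :=
  ⨅ c ∈ {c : Fin m → ℝ | c ⬝ᵥ c = 1 ∧ c ⬝ᵥ cp = 0}, ENNReal.ofReal (objective A v cp ε c)

/-- `z_max ∈ [0, ∞]`: the limit of `minObjective` as `ε → 0⁺`. It is taken as an upper limit, so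
that no existence of the limit has to be assumed; see `zMax_eq_of_tendsto`. -/
def zMax (A : Fin m → Matrix (Fin n) (Fin n) 𝕜) (v : Fin m → Fin n → 𝕜) (cp : Fin m → ℝ) : ℝ≥0∞ :=
  Filter.limsup (fun ε : ℝ => minObjective A v cp ε) (𝓝[>] 0)

theorem zMax_eq_of_tendsto {A : Fin m → Matrix (Fin n) (Fin n) 𝕜} {v : Fin m → Fin n → 𝕜}
    {cp : Fin m → ℝ} {z : ℝ≥0∞}
    (h : Filter.Tendsto (fun ε : ℝ => minObjective A v cp ε) (𝓝[>] 0) (𝓝 z)) :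
    zMax A v cp = z :=
  h.limsup_eq

/-- The part `{f x : |x - x₀|₊ ^ 2 ≤ z_max}` of the image. -/
def cutImage (A : Fin m → Matrix (Fin n) (Fin n) 𝕜) (v : Fin m → Fin n → 𝕜) (f0 : Fin m → ℝ)
    (cp : Fin m → ℝ) : Set (Fin m → ℝ) :=
  quadMap A v f0 ''
    {x | ENNReal.ofReal (normSqOf (combMat cp A) (x - basePoint A v cp)) ≤ zMax A v cp}

end QuadMap

end

/-! Write `x = x₀ + y`. The identity `c₊ · f(x₀ + y) = c₊ · f(x₀) + |y|₊²` makes level sets of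
`|y|₊²` the slices of the image by hyperplanes orthogonal to `c₊`. A convex combination `p` of `f(x₀
+ y₁)` and `f(x₀ + y₂)` lies in the hyperplane of level `z = a|y₁|₊² + b|y₂|₊²`, and the point is to
solve `f(x₀ + y) = p` on `|y|₊² = z` whenever `z < z_max`.

Fix a small `ε > 0` at which the minimized quantity exceeds `z`. For a unit vector `c ⟂ c₊`, the
function `c · f(x₀ + y) + ε|y|²` has a Lagrange multiplier on the level set for which the Lagrangian
is strictly convex: the unconstrained solution for the multiplier `λ_min` lies outside the level
set, and lowering the multiplier brings the solution onto it (`exists_multiplier`,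
`exists_penalized_minimizer`). So there is a minimizer `x(c)` with quadratic growth; hence `c ↦
x(c)` is Lipschitz, and comparing the Lagrangian at `x(c)` with its values at `y₁` and `y₂` gives `c
· (f(x₀ + x(c)) - p) ≤ εR`.

The map `x` extends from the unit sphere of `c₊^⊥` to the ball, with values still in the level set,
because `m - 1 < dim V` (`exists_continuousOn_extension`). Brouwer's theorem applied to `f(x₀ +
X(c)) - p - εR c` on the ball of `c₊^⊥` yields a point where `|f(x₀ + X(c)) - p| ≤ εR`. Letting `ε →
0` and using compactness of the level set gives `p` exactly (`exists_quadMap_eq_combination`).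

The dimension hypothesis is needed only as `≠`: if `m - 1 > dim V`, some unit `c ⟂ c₊` kills `c · (v
- A x₀)`, so `z_max = 0` and the set is a single point. The level `z = z_max < ∞` follows by
closedness. -/

namespace QuadMap

/-! ### Brouwer's theorem by the volume-polynomial argument. -/

section Brouwer

open Metric MeasureTheory

/-- The determinants `det (1 + D)` and `det (1 + t j • D)` satisfy an interpolation identity whose
coefficients do not depend on `D`. -/
theorem exists_det_interpolation (F : Type*) [AddCommGroup F] [Module ℝ F] [FiniteDimensional ℝ F]
    {δ : ℝ} (hδ : 0 < δ) :
    ∃ (s : Finset ℕ) (t a : ℕ → ℝ), (∀ j ∈ s, 0 < t j ∧ t j ≤ δ) ∧ ∑ j ∈ s, a j = 1 ∧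
      ∀ D : F →ₗ[ℝ] F, LinearMap.det (1 + D) = ∑ j ∈ s, a j * LinearMap.det (1 + t j • D) := by
  classical
  set d := Module.finrank ℝ F with hd
  let s : Finset ℕ := Finset.range (d + 1)
  -- For fixed `D`, `det (1 + r • D)` is a polynomial in `r` of degree at most `d`, so its value at
  -- `1` is determined by any `d + 1` distinct nodes; these are chosen in `(0, δ]`. The weights are
  -- the Lagrange basis polynomials at `1`, hence independent of `D`.
  let t : ℕ → ℝ := fun j => δ / (j + 1)
  have ht : Set.InjOn t s := by
    intro i _ j _ hij
    have hi : (0 : ℝ) < i + 1 := by positivity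
    have hj : (0 : ℝ) < j + 1 := by positivity
    have hij' : δ / ((i : ℝ) + 1) = δ / (j + 1) := hij
    rw [div_eq_div_iff hi.ne' hj.ne'] at hij'
    have := mul_left_cancel₀ hδ.ne' hij'
    exact_mod_cast (add_right_cancel this).symm
  refine ⟨s, t, fun j => (Lagrange.basis s t j).eval 1, ?_, ?_, ?_⟩
  · intro j _
    refine ⟨by positivity, div_le_self hδ.le ?_⟩
    linarith [(Nat.cast_nonneg j : (0 : ℝ) ≤ j)]
  · rw [← Polynomial.eval_finsetSum, Lagrange.sum_basis ht ⟨0, by simp [s]⟩, Polynomial.eval_one]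
  · intro D
    let b := Module.finBasis ℝ F
    let M : Matrix (Fin d) (Fin d) ℝ := LinearMap.toMatrix b b D
    let q : Polynomial ℝ :=
      ((Polynomial.X : Polynomial ℝ) • M.map Polynomial.C + (1 : Matrix (Fin d) (Fin d) ℝ).map Polynomial.C).det
    have hq : ∀ r : ℝ, q.eval r = LinearMap.det (1 + r • D) := by
      intro r
      rw [← LinearMap.det_toMatrix b, map_add, map_smul, LinearMap.toMatrix_one]
      simp only [q]
      rw [← Polynomial.coe_evalRingHom, RingHom.map_det]
      congr 1
      ext i j
      simp [M, add_comm, Matrix.one_apply, apply_ite]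
      exact mul_comm _ _
    have hdeg : q.degree < (s.card : WithBot ℕ) := by
      refine lt_of_le_of_lt Polynomial.degree_le_natDegree ?_
      have := Polynomial.natDegree_det_X_add_C_le M 1
      rw [Fintype.card_fin] at this
      simp only [s, Finset.card_range]
      exact_mod_cast Nat.lt_succ_of_le this
    have h1 := Lagrange.eq_interpolate ht hdeg
    have h2 := hq 1
    rw [one_smul] at h2
    rw [← h2, h1, Lagrange.interpolate_apply, Polynomial.eval_finsetSum]
    refine Finset.sum_congr rfl fun j _ => ?_
    rw [Polynomial.eval_mul, Polynomial.eval_C, hq, mul_comm]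

variable {F : Type*} [NormedAddCommGroup F] [InnerProductSpace ℝ F] [FiniteDimensional ℝ F]

/-- Along the segment from `1` to `1 + D` the determinant never vanishes, since `x = -s D x` forces
`x = 0`; it starts at `1` and so stays positive. -/
theorem det_one_add_pos {D : F →L[ℝ] F} (hD : ‖D‖ < 1) :
    0 < LinearMap.det (1 + (D : F →ₗ[ℝ] F)) := by
  have hne : ∀ s ∈ Set.Icc (0 : ℝ) 1, (1 + s • D).det ≠ 0 := by
    intro s hs h0
    have := LinearMap.bot_lt_ker_of_det_eq_zero (f := ((1 + s • D : F →L[ℝ] F) : F →ₗ[ℝ] F)) h0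
    obtain ⟨x, hx, hx0⟩ := (Submodule.ne_bot_iff _).1 this.ne'
    have hx' : x + s • D x = 0 := by simpa using hx
    have h1 : x = -(s • D x) := eq_neg_of_add_eq_zero_left hx'
    have h2 : ‖x‖ ≤ ‖D‖ * ‖x‖ := by
      calc ‖x‖ = ‖s • D x‖ := by rw [h1, norm_neg, ← h1]
        _ = s * ‖D x‖ := by rw [norm_smul, Real.norm_of_nonneg hs.1]
        _ ≤ 1 * ‖D x‖ := by gcongr; exact hs.2
        _ ≤ _ := by rw [one_mul]; exact D.le_opNorm x
    have h3 : 0 < ‖x‖ := norm_pos_iff.2 hx0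
    nlinarith
  have hcont : ContinuousOn (fun s : ℝ => (1 + s • D).det) (Set.Icc 0 1) :=
    (ContinuousLinearMap.continuous_det.comp (by fun_prop)).continuousOn
  by_contra hneg
  have h1 : (1 + (1 : ℝ) • D).det ≤ 0 := by rw [one_smul]; exact not_lt.1 hneg
  have h0 : (0 : ℝ) ≤ (1 + (0 : ℝ) • D).det := by
    rw [zero_smul, add_zero]
    exact zero_le_one.trans_eq (LinearMap.det_id (M := F) (A := ℝ)).symm
  obtain ⟨s, hs, hs0⟩ := intermediate_value_Icc' zero_le_one hcont ⟨h1, h0⟩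
  exact hne s hs hs0

/-- A Lipschitz perturbation of the identity with small constant that is supported in the unit ball
preserves the volume of the ball. -/
theorem setIntegral_det_eq_measureReal_ball [MeasurableSpace F] [BorelSpace F] (μ : Measure F)
    [μ.IsAddHaarMeasure] {ψ : F → F} {K : NNReal} (hψ : LipschitzWith K ψ)
    (hout : ∀ x, x ∉ ball (0 : F) 1 → ψ x = 0) (hd : ∀ x ∈ ball (0 : F) 1, DifferentiableAt ℝ ψ x)
    {t : ℝ} (ht : 0 ≤ t) (htK : t * K < 1) :
    IntegrableOn (fun x => LinearMap.det (1 + t • (fderiv ℝ ψ x : F →ₗ[ℝ] F))) (ball 0 1) μ ∧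
    ∫ x in ball (0 : F) 1, LinearMap.det (1 + t • (fderiv ℝ ψ x : F →ₗ[ℝ] F)) ∂μ
      = μ.real (ball 0 1) := by
  set h : F → F := fun x => x + t • ψ x with hh
  lift t to NNReal using ht
  have happ : ApproximatesLinearOn h ((ContinuousLinearEquiv.refl ℝ F : F ≃L[ℝ] F) : F →L[ℝ] F)
      Set.univ (t * K) := by
    intro x _ y _
    have : h x - h y - ((ContinuousLinearEquiv.refl ℝ F : F ≃L[ℝ] F) : F →L[ℝ] F) (x - y)
        = (t : ℝ) • (ψ x - ψ y) := by
      simp [hh, smul_sub]; abel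
    rw [this, norm_smul, Real.norm_of_nonneg t.coe_nonneg, NNReal.coe_mul, mul_assoc]
    gcongr
    exact hψ.norm_sub_le x y
  have hc : Subsingleton F ∨
      t * K < ‖((ContinuousLinearEquiv.refl ℝ F).symm : F →L[ℝ] F)‖₊⁻¹ := by
    rcases subsingleton_or_nontrivial F with hF | hF
    · exact Or.inl hF
    · right
      have : ‖((ContinuousLinearEquiv.refl ℝ F).symm : F →L[ℝ] F)‖₊ = 1 := by
        ext; simp
      rw [this, inv_one]
      exact_mod_cast htK
  have hinj : Function.Injective h := by
    intro x y hxy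
    have := happ.injective hc (a₁ := ⟨x, trivial⟩) (a₂ := ⟨y, trivial⟩) hxy
    exact congrArg Subtype.val this
  have hsurj : Function.Surjective h := happ.surjective hc
  have hfix : ∀ x, x ∉ ball (0 : F) 1 → h x = x := fun x hx => by simp [hh, hout x hx]
  -- A bijection of the whole space that fixes every point outside the ball must map the ball onto
  -- itself.
  have himg : h '' ball 0 1 = ball 0 1 := by
    ext y
    constructor
    · rintro ⟨x, hx, rfl⟩
      by_contra hy
      exact hy (by rwa [hinj (hfix _ hy)])
    · intro hy
      obtain ⟨x, rfl⟩ := hsurj y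
      refine ⟨x, ?_, rfl⟩
      by_contra hx
      exact hx (by rwa [hfix x hx] at hy)
  have hnorm : ∀ x ∈ ball (0 : F) 1, ‖(t : ℝ) • fderiv ℝ ψ x‖ < 1 := by
    intro x _
    rw [norm_smul, Real.norm_of_nonneg t.coe_nonneg]
    exact lt_of_le_of_lt (mul_le_mul_of_nonneg_left (norm_fderiv_le_of_lipschitz ℝ hψ) t.2) htK
  have hpos : ∀ x ∈ ball (0 : F) 1,
      0 < LinearMap.det (1 + (t : ℝ) • (fderiv ℝ ψ x : F →ₗ[ℝ] F)) :=
    fun x hx => det_one_add_pos (hnorm x hx)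
  have hder : ∀ x ∈ ball (0 : F) 1,
      HasFDerivWithinAt h (1 + (t : ℝ) • fderiv ℝ ψ x) (ball 0 1) x := fun x hx =>
    ((hasFDerivAt_id x).add ((hd x hx).hasFDerivAt.const_smul (t : ℝ))).hasFDerivWithinAt
  have hint := integral_image_eq_integral_abs_det_fderiv_smul μ measurableSet_ball hder hinj.injOn
    (fun _ => (1 : ℝ))
  have hii := integrableOn_image_iff_integrableOn_abs_det_fderiv_smul μ measurableSet_ball hder
    hinj.injOn (fun _ => (1 : ℝ))
  rw [himg] at hint hii
  have heq : Set.EqOn (fun x => |(1 + (t : ℝ) • fderiv ℝ ψ x).det| • (1 : ℝ))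
      (fun x => LinearMap.det (1 + (t : ℝ) • (fderiv ℝ ψ x : F →ₗ[ℝ] F))) (ball 0 1) := by
    intro x hx
    simp only [smul_eq_mul, mul_one]
    exact abs_of_pos (hpos x hx)
  refine ⟨?_, ?_⟩
  · refine (integrableOn_congr_fun heq measurableSet_ball).1 (hii.1 ?_)
    exact integrableOn_const (measure_ball_lt_top.ne)
  · rw [setIntegral_congr_fun measurableSet_ball heq] at hint
    rw [← hint]
    simp [Measure.real]

/-- There is no continuously differentiable retraction of the unit ball onto the unit sphere. -/
theorem not_exists_contDiff_retraction [Nontrivial F] {r : F → F}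
    (hr : ∀ x ∈ closedBall (0 : F) 1, ContDiffAt ℝ 1 r x)
    (hn : ∀ x ∈ closedBall (0 : F) 1, ‖r x‖ = 1) (hid : ∀ x ∈ sphere (0 : F) 1, r x = x) :
    False := by
  classical
  have hdiff : ∀ x ∈ closedBall (0 : F) 1, DifferentiableAt ℝ (fun y => r y - y) x :=
    fun x hx => ((hr x hx).differentiableAt one_ne_zero).sub differentiableAt_id
  obtain ⟨K, hK⟩ : ∃ K : NNReal, LipschitzOnWith K (fun y => r y - y) (closedBall 0 1) := by
    refine LocallyLipschitzOn.exists_lipschitzOnWith_of_compact (isCompact_closedBall 0 1) ?_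
    intro x hx
    obtain ⟨K, s, hs, hK⟩ := ((hr x hx).sub contDiffAt_id).exists_lipschitzOnWith
    exact ⟨K, s, mem_nhdsWithin_of_mem_nhds hs, hK⟩
  -- Since `r x - x` vanishes on the sphere, extension by zero keeps the Lipschitz constant `K`. The
  -- segment between an inner and an outer point crosses the sphere; in norms, this is the decay `‖ψ
  -- x‖ ≤ K (1 - ‖x‖)`.
  set ψ : F → F := fun x => if x ∈ ball (0 : F) 1 then r x - x else 0 with hψdef
  have hψin : ∀ x ∈ ball (0 : F) 1, ψ x = r x - x := fun x hx => if_pos hx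
  have hψout : ∀ x, x ∉ ball (0 : F) 1 → ψ x = 0 := fun x hx => if_neg hx
  have hdecay : ∀ x ∈ ball (0 : F) 1, ‖ψ x‖ ≤ K * (1 - ‖x‖) := by
    intro x hx
    have hx1 : ‖x‖ < 1 := by simpa using hx
    obtain ⟨u, hu1, hu⟩ : ∃ u : F, ‖u‖ = 1 ∧ ‖x - u‖ = 1 - ‖x‖ := by
      rcases eq_or_ne x 0 with rfl | hx0
      · obtain ⟨u, hu⟩ := exists_norm_eq F zero_le_one
        exact ⟨u, hu, by simp [hu]⟩
      · have hpos : 0 < ‖x‖ := norm_pos_iff.2 hx0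
        refine ⟨‖x‖⁻¹ • x, norm_smul_inv_norm (𝕜 := ℝ) hx0, ?_⟩
        have : x - ‖x‖⁻¹ • x = (1 - ‖x‖⁻¹) • x := by rw [sub_smul, one_smul]
        rw [this, norm_smul, Real.norm_eq_abs, abs_of_nonpos, neg_sub, sub_mul, one_mul,
          inv_mul_cancel₀ hpos.ne']
        rw [sub_nonpos]
        exact (one_le_inv₀ hpos).2 hx1.le
    have h := hK.norm_sub_le (ball_subset_closedBall hx) (y := u) (by simp [hu1])
    rw [hu, hid u (by simp [hu1]), sub_self, sub_zero] at h
    rwa [hψin x hx]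
  have hmixed : ∀ x ∈ ball (0 : F) 1, ∀ y, y ∉ ball (0 : F) 1 → ‖ψ x - ψ y‖ ≤ K * ‖x - y‖ := by
    intro x hx y hy
    rw [hψout y hy, sub_zero]
    refine (hdecay x hx).trans (mul_le_mul_of_nonneg_left ?_ K.2)
    have h1 : 1 ≤ ‖y‖ := by simpa using hy
    have h2 := norm_sub_norm_le y x
    rw [norm_sub_rev y x] at h2
    linarith
  have hψ : LipschitzWith K ψ := by
    refine LipschitzWith.of_dist_le_mul fun x y => ?_
    rw [dist_eq_norm, dist_eq_norm]
    by_cases hx : x ∈ ball (0 : F) 1 <;> by_cases hy : y ∈ ball (0 : F) 1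
    · rw [hψin x hx, hψin y hy]
      exact hK.norm_sub_le (ball_subset_closedBall hx) (ball_subset_closedBall hy)
    · exact hmixed x hx y hy
    · rw [norm_sub_rev (ψ x), norm_sub_rev x]
      exact hmixed y hy x hx
    · rw [hψout x hx, hψout y hy, sub_self, norm_zero]
      positivity
  have hev : ∀ x ∈ ball (0 : F) 1, ψ =ᶠ[𝓝 x] fun y => r y - y := fun x hx =>
    Filter.eventuallyEq_of_mem (isOpen_ball.mem_nhds hx) hψin
  have hdψ : ∀ x ∈ ball (0 : F) 1, DifferentiableAt ℝ ψ x := fun x hx =>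
    (hdiff x (ball_subset_closedBall hx)).congr_of_eventuallyEq (hev x hx)
  have hdet : ∀ x ∈ ball (0 : F) 1, LinearMap.det (1 + (fderiv ℝ ψ x : F →ₗ[ℝ] F)) = 0 := by
    intro x hx
    have hrd := (hr x (ball_subset_closedBall hx)).differentiableAt one_ne_zero
    have hfd : fderiv ℝ ψ x = fderiv ℝ r x - ContinuousLinearMap.id ℝ F := by
      rw [(hev x hx).fderiv_eq]
      exact (hrd.hasFDerivAt.sub (hasFDerivAt_id x)).fderiv
    have h1 : (1 + (fderiv ℝ ψ x : F →ₗ[ℝ] F)) = (fderiv ℝ r x : F →ₗ[ℝ] F) := by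
      ext v; simp [hfd]
    rw [h1]
    by_contra hne
    -- Differentiating `‖r‖² = 1` shows that the derivative of `r` misses the direction `r x`, so it
    -- cannot be surjective.
    have hperp : ∀ v, inner ℝ (r x) (fderiv ℝ r x v) = 0 := by
      intro v
      have hconst : (fun y => inner ℝ (r y) (r y)) =ᶠ[𝓝 x] fun _ => (1 : ℝ) := by
        refine Filter.eventuallyEq_of_mem (isOpen_ball.mem_nhds hx) fun y hy => ?_
        simp only [real_inner_self_eq_norm_sq, hn y (ball_subset_closedBall hy), one_pow]
      have h2 := (hrd.hasFDerivAt.inner ℝ hrd.hasFDerivAt).fderiv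
      rw [hconst.fderiv_eq, fderiv_const_apply] at h2
      have h3 := DFunLike.congr_fun h2 v
      simp only [zero_apply, ContinuousLinearMap.comp_apply,
        ContinuousLinearMap.prod_apply, fderivInnerCLM_apply] at h3
      rw [real_inner_comm (r x) (fderiv ℝ r x v)] at h3
      linarith
    obtain ⟨v, hv⟩ := (LinearMap.equivOfDetNeZero _ hne).surjective (r x)
    have hv' : fderiv ℝ r x v = r x := hv
    have h4 := hperp v
    rw [hv', real_inner_self_eq_norm_sq, hn x (ball_subset_closedBall hx)] at h4
    norm_num at h4
  let δ : ℝ := 1 / (K + 1)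
  have hδ : 0 < δ := by positivity
  obtain ⟨s, t, a, hts, ha, hinterp⟩ := exists_det_interpolation F hδ
  let _ : MeasurableSpace F := borel F
  have : BorelSpace F := ⟨rfl⟩
  let μ : Measure F := Measure.addHaar
  have hj : ∀ j ∈ s, t j * K < 1 := fun j hjs => by
    have hK1 : (0 : ℝ) < K + 1 := by positivity
    calc t j * K ≤ δ * K := mul_le_mul_of_nonneg_right (hts j hjs).2 K.2
      _ = K / (K + 1) := by simp only [δ]; ring
      _ < 1 := (div_lt_one hK1).2 (by linarith)
  have hI := fun j hjs =>
    setIntegral_det_eq_measureReal_ball μ hψ hψout hdψ (hts j hjs).1.le (hj j hjs)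
  have h0 : ∫ x in ball (0 : F) 1, LinearMap.det (1 + (fderiv ℝ ψ x : F →ₗ[ℝ] F)) ∂μ = 0 := by
    rw [setIntegral_congr_fun measurableSet_ball hdet]
    simp
  -- The integral at `t = 1` is interpolated from small `t`, where it equals the volume of the ball;
  -- as the weights sum to `1`, it is that volume again, although the integrand is zero.
  have h1 : ∫ x in ball (0 : F) 1, LinearMap.det (1 + (fderiv ℝ ψ x : F →ₗ[ℝ] F)) ∂μ
      = μ.real (ball 0 1) := by
    rw [integral_congr_ae (Filter.Eventually.of_forall fun x =>
      hinterp (fderiv ℝ ψ x : F →ₗ[ℝ] F))]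
    rw [integral_finsetSum _ fun j hjs => (hI j hjs).1.const_mul (a j)]
    simp_rw [integral_const_mul]
    rw [Finset.sum_congr rfl fun j hjs => by rw [(hI j hjs).2], ← Finset.sum_mul, ha, one_mul]
  rw [h0] at h1
  have : 0 < μ.real (ball (0 : F) 1) :=
    ENNReal.toReal_pos (measure_ball_pos μ 0 one_pos).ne' measure_ball_lt_top.ne
  exact this.ne h1

/-- **Brouwer's theorem** in the form of a statement about zeros of inward pointing vector
fields. -/
theorem exists_zero_of_inner_nonpos {g : F → F} (hg : ContinuousOn g (closedBall 0 1))
    (hb : ∀ c ∈ sphere (0 : F) 1, inner ℝ c (g c) ≤ 0) : ∃ c ∈ closedBall (0 : F) 1, g c = 0 := by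
  rcases subsingleton_or_nontrivial F with hF | hF
  · exact ⟨0, by simp, Subsingleton.elim _ _⟩
  by_contra! hne
  obtain ⟨g₁, hg₁⟩ := ContinuousMap.exists_restrict_eq (isClosed_closedBall (x := (0 : F)) (ε := 1))
    ⟨_, hg.domRestrict⟩
  have hg₁' : ∀ c ∈ closedBall (0 : F) 1, g₁ c = g c := fun c hc =>
    DFunLike.congr_fun hg₁ ⟨c, hc⟩
  obtain ⟨c₀, hc₀, hmin⟩ := (isCompact_closedBall (0 : F) 1).exists_isMinOn ⟨0, by simp⟩ hg.norm
  -- Of the lower bound `4η` for `‖g‖`, the term `2η c` uses at most `2η` and the smooth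
  -- approximation less than `η`, so `q` does not vanish. On the sphere the gain `2η` beats the
  -- error `η`, so `q` points strictly outwards.
  set η : ℝ := ‖g c₀‖ / 4 with hη
  have hη0 : 0 < η := by have := norm_pos_iff.2 (hne c₀ hc₀); positivity
  have hηle : ∀ c ∈ closedBall (0 : F) 1, 4 * η ≤ ‖g c‖ := fun c hc => by
    have : ‖g c₀‖ ≤ ‖g c‖ := hmin hc
    linarith
  -- a smooth field pointing strictly outwards on the sphere
  obtain ⟨q, hq, hqd⟩ : ∃ q : F → F, ContDiff ℝ 1 q ∧
      ∀ c ∈ closedBall (0 : F) 1, ‖q c - (2 * η) • c + g c‖ < η := by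
    have hd := ContinuousMap.dense_setOfPred_contDiff (E := F) (F := F)
    have hg₂ : ContinuousMap.mk (fun c : F => (2 * η) • c - g₁ c) (by fun_prop) ∈
        closure {f : C(F, F) | ContDiff ℝ (⊤ : ℕ∞) f} := hd _
    rw [mem_closure_iff_nhds_basis
      (nhds_basis_uniformity uniformity_basis_dist.compactConvergenceUniformity)] at hg₂
    obtain ⟨q, hq, hqd⟩ := hg₂ (closedBall (0 : F) 1, η) ⟨isCompact_closedBall 0 1, hη0⟩
    rw [Set.mem_ofPred_eq] at hq
    refine ⟨q, hq.of_le (by exact_mod_cast le_top), fun c hc => ?_⟩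
    have := hqd c hc
    simp only [ContinuousMap.coe_mk, Set.mem_ofPred_eq, dist_eq_norm, hg₁' c hc] at this
    rwa [sub_add]
  have hq0 : ∀ c ∈ closedBall (0 : F) 1, q c ≠ 0 := by
    intro c hc h0
    have h1 := hqd c hc
    rw [h0, zero_sub, neg_add_eq_sub] at h1
    have h2 := norm_sub_norm_le (g c) ((2 * η) • c)
    have h3 : ‖(2 * η) • c‖ ≤ 2 * η := by
      rw [norm_smul, Real.norm_of_nonneg (by positivity)]
      exact mul_le_of_le_one_right (by positivity) (by simpa using hc)
    linarith [hηle c hc]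
  have hqs : ∀ c ∈ sphere (0 : F) 1, 0 < inner ℝ c (q c) := by
    intro c hc
    have hc1 : ‖c‖ = 1 := by simpa using hc
    have h1 := hqd c (sphere_subset_closedBall hc)
    have h2 : -η < inner ℝ c (q c - (2 * η) • c + g c) := by
      have := abs_real_inner_le_norm c (q c - (2 * η) • c + g c)
      rw [hc1, one_mul] at this
      linarith [neg_le_of_abs_le this]
    rw [inner_add_right, inner_sub_right, real_inner_smul_right, real_inner_self_eq_norm_sq,
      hc1] at h2
    linarith [hb c hc]
  obtain ⟨κ, hκ0, hκ1, hκ⟩ : ∃ κ : ℝ, 0 < κ ∧ κ < 1 ∧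
      ∀ c ∈ closedBall (0 : F) 1, κ ≤ ‖c‖ → 0 < inner ℝ c (q c) := by
    let T : Set F := closedBall (0 : F) 1 ∩ {c | inner ℝ c (q c) ≤ 0}
    have hT : IsCompact T := (isCompact_closedBall 0 1).inter_right
      (isClosed_le (continuous_id.inner hq.continuous) continuous_const)
    have hT0 : (0 : F) ∈ T := ⟨by simp, by simp⟩
    obtain ⟨c₁, hc₁, hmax⟩ := hT.exists_isMaxOn ⟨0, hT0⟩ continuous_norm.continuousOn
    have hlt : ‖c₁‖ < 1 := by
      refine lt_of_le_of_ne (by simpa using hc₁.1) fun h => ?_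
      exact absurd (hqs c₁ (by simpa using h)) (not_lt.2 hc₁.2)
    refine ⟨(1 + ‖c₁‖) / 2, by positivity, by linarith, fun c hc hcn => ?_⟩
    by_contra hcon
    have : ‖c‖ ≤ ‖c₁‖ := hmax (show c ∈ T from ⟨hc, not_lt.1 hcon⟩)
    linarith
  let φ : ContDiffBump (0 : F) := ⟨κ, 1, hκ0, hκ1⟩
  -- Near the sphere both `q c` and `c` have positive inner product with `c`, so the interpolation
  -- has no zero; it is the identity on the sphere, and its normalization is a retraction.
  let G : F → F := fun c => φ c • q c + (1 - φ c) • c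
  have hφ : ContDiff ℝ 1 φ := φ.contDiff (n := 1)
  have hG : ContDiff ℝ 1 G := (hφ.smul hq).add ((contDiff_const.sub hφ).smul contDiff_id)
  have hG0 : ∀ c ∈ closedBall (0 : F) 1, G c ≠ 0 := by
    intro c hc h0
    rcases le_or_gt ‖c‖ κ with hck | hck
    · have h1 : φ c = 1 := φ.one_of_mem_closedBall (by simpa using hck)
      simp only [G, h1, one_smul, sub_self, zero_smul, add_zero] at h0
      exact hq0 c hc h0
    · have h1 : inner ℝ c (G c) = φ c * inner ℝ c (q c) + (1 - φ c) * ‖c‖ ^ 2 := by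
        simp only [G]
        rw [inner_add_right, real_inner_smul_right, real_inner_smul_right,
          real_inner_self_eq_norm_sq]
      rw [h0, inner_zero_right] at h1
      have h2 := hκ c hc hck.le
      have h3 : 0 < ‖c‖ ^ 2 := by have := hκ0.trans hck; positivity
      have h4 : 0 ≤ φ c := φ.nonneg
      have h5 : φ c ≤ 1 := φ.le_one
      rcases h4.eq_or_lt with h6 | h6
      · rw [← h6] at h1; linarith
      · nlinarith [mul_pos h6 h2, mul_nonneg (sub_nonneg.2 h5) h3.le]
  refine not_exists_contDiff_retraction (r := fun c => ‖G c‖⁻¹ • G c) ?_ ?_ ?_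
  · intro c hc
    exact ((hG.contDiffAt.norm ℝ (hG0 c hc)).inv (norm_ne_zero_iff.2 (hG0 c hc))).smul
      hG.contDiffAt
  · intro c hc
    exact norm_smul_inv_norm (𝕜 := ℝ) (hG0 c hc)
  · intro c hc
    have hc1 : ‖c‖ = 1 := by simpa using hc
    have h1 : φ c = 0 := φ.zero_of_le_dist (by simp [φ, hc1])
    simp [G, h1, hc1]

end Brouwer

/-! ### Extending Lipschitz maps from the sphere into a level set. -/

section Extension

open Metric

/-- The homogeneous extension of a Lipschitz map on the unit sphere is Lipschitz. -/
theorem exists_lipschitzWith_homogeneous {F E : Type*} [NormedAddCommGroup F] [NormedSpace ℝ F]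
    [FiniteDimensional ℝ F] [NormedAddCommGroup E] [NormedSpace ℝ E] {K : NNReal} {x : F → E}
    (hx : LipschitzOnWith K x (sphere 0 1)) :
    ∃ K' : NNReal, LipschitzWith K' (fun c : F => ‖c‖ • x (‖c‖⁻¹ • c)) := by
  obtain ⟨R, hR⟩ := (isCompact_sphere (0 : F) 1).exists_bound_of_continuousOn hx.continuousOn
  have hunit : ∀ c : F, c ≠ 0 → ‖c‖⁻¹ • c ∈ sphere (0 : F) 1 := fun c hc => by
    simpa using norm_smul_inv_norm (𝕜 := ℝ) hc
  have hzero : ∀ c : F, ‖(‖c‖ • x (‖c‖⁻¹ • c))‖ ≤ |R| * ‖c‖ := by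
    intro c
    rcases eq_or_ne c 0 with rfl | hc
    · simp
    · rw [norm_smul, norm_norm, mul_comm]
      exact mul_le_mul_of_nonneg_right ((hR _ (hunit c hc)).trans (le_abs_self R)) (norm_nonneg _)
  refine ⟨2 * K + Real.nnabs R, LipschitzWith.of_dist_le_mul fun c d => ?_⟩
  rw [dist_eq_norm, dist_eq_norm, NNReal.coe_add, NNReal.coe_mul,
    NNReal.coe_ofNat, Real.coe_nnabs]
  have hK : (0 : ℝ) ≤ 2 * K := by positivity
  rcases eq_or_ne c 0 with rfl | hc
  · rw [norm_zero, zero_smul, zero_sub, zero_sub, norm_neg, norm_neg]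
    exact (hzero d).trans (mul_le_mul_of_nonneg_right (by linarith) (norm_nonneg _))
  rcases eq_or_ne d 0 with rfl | hd
  · rw [norm_zero, zero_smul, sub_zero, sub_zero]
    exact (hzero c).trans (mul_le_mul_of_nonneg_right (by linarith) (norm_nonneg _))
  have hc0 : ‖c‖ ≠ 0 := norm_ne_zero_iff.2 hc
  have hd0 : ‖d‖ ≠ 0 := norm_ne_zero_iff.2 hd
  have hcd : |‖d‖ - ‖c‖| ≤ ‖c - d‖ := by
    rw [norm_sub_rev]; exact abs_norm_sub_norm_le d c
  have hdir : ‖c‖ * ‖‖c‖⁻¹ • c - ‖d‖⁻¹ • d‖ ≤ 2 * ‖c - d‖ := by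
    have h1 : ‖c‖ • (‖c‖⁻¹ • c - ‖d‖⁻¹ • d) = (c - d) + ((‖d‖ - ‖c‖) * ‖d‖⁻¹) • d := by
      rw [smul_sub, smul_smul, smul_smul, mul_inv_cancel₀ hc0, sub_mul, mul_inv_cancel₀ hd0,
        sub_smul, one_smul, one_smul]
      abel
    calc ‖c‖ * ‖‖c‖⁻¹ • c - ‖d‖⁻¹ • d‖ = ‖‖c‖ • (‖c‖⁻¹ • c - ‖d‖⁻¹ • d)‖ := by
          rw [norm_smul, norm_norm]
      _ ≤ ‖c - d‖ + ‖((‖d‖ - ‖c‖) * ‖d‖⁻¹) • d‖ := by rw [h1]; exact norm_add_le _ _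
      _ = ‖c - d‖ + |‖d‖ - ‖c‖| := by
          rw [norm_smul, norm_mul, norm_inv, norm_norm, mul_assoc, inv_mul_cancel₀ hd0, mul_one,
            Real.norm_eq_abs]
      _ ≤ 2 * ‖c - d‖ := by linarith
  have hsplit : ‖c‖ • x (‖c‖⁻¹ • c) - ‖d‖ • x (‖d‖⁻¹ • d)
      = ‖c‖ • (x (‖c‖⁻¹ • c) - x (‖d‖⁻¹ • d)) + (‖c‖ - ‖d‖) • x (‖d‖⁻¹ • d) := by
    rw [smul_sub, sub_smul]; abel
  calc ‖‖c‖ • x (‖c‖⁻¹ • c) - ‖d‖ • x (‖d‖⁻¹ • d)‖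
      ≤ ‖c‖ * ‖x (‖c‖⁻¹ • c) - x (‖d‖⁻¹ • d)‖ + |‖c‖ - ‖d‖| * ‖x (‖d‖⁻¹ • d)‖ := by
        rw [hsplit]
        refine (norm_add_le _ _).trans_eq ?_
        rw [norm_smul, norm_smul, norm_norm, Real.norm_eq_abs]
    _ ≤ ‖c‖ * (K * ‖‖c‖⁻¹ • c - ‖d‖⁻¹ • d‖) + ‖c - d‖ * |R| := by
        gcongr
        · exact hx.norm_sub_le (hunit c hc) (hunit d hd)
        · exact abs_norm_sub_norm_le c d
        · exact (hR _ (hunit d hd)).trans (le_abs_self R)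
    _ = K * (‖c‖ * ‖‖c‖⁻¹ • c - ‖d‖⁻¹ • d‖) + ‖c - d‖ * |R| := by ring
    _ ≤ K * (2 * ‖c - d‖) + ‖c - d‖ * |R| := by gcongr
    _ = (2 * K + |R|) * ‖c - d‖ := by ring

/-- A Lipschitz map from the unit sphere of `F` into a level set of a positive definite
homogeneous function on a space of larger dimension extends to the unit ball. -/
theorem exists_continuousOn_extension {F E : Type*} [NormedAddCommGroup F] [NormedSpace ℝ F]
    [FiniteDimensional ℝ F] [NormedAddCommGroup E] [NormedSpace ℝ E] [FiniteDimensional ℝ E]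
    (hFE : Module.finrank ℝ F < Module.finrank ℝ E) {q : E → ℝ} (hq : Continuous q)
    (hhom : ∀ (t : ℝ) (y : E), q (t • y) = t ^ 2 * q y) (hpos : ∀ y, y ≠ 0 → 0 < q y)
    {z : ℝ} (hz : 0 < z) {K : NNReal} {x : F → E} (hx : LipschitzOnWith K x (sphere 0 1))
    (hxz : ∀ c ∈ sphere (0 : F) 1, q (x c) = z) :
    ∃ X : F → E, ContinuousOn X (closedBall 0 1) ∧ (∀ c ∈ closedBall (0 : F) 1, q (X c) = z) ∧
      ∀ c ∈ sphere (0 : F) 1, X c = x c := by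
  obtain ⟨K', hK'⟩ := exists_lipschitzWith_homogeneous hx
  set H : F → E := fun c => ‖c‖ • x (‖c‖⁻¹ • c) with hH
  -- A Lipschitz image of `F` has Hausdorff dimension at most `finrank ℝ F`, so it cannot fill `E`.
  obtain ⟨w, hw⟩ : ∃ w, w ∉ Set.range H := by
    have hdim : dimH (Set.range H) < Module.finrank ℝ E := by
      refine hK'.dimH_range_le.trans_lt ?_
      rw [Real.dimH_univ_eq_finrank]
      exact_mod_cast hFE
    exact (dense_compl_of_dimH_lt_finrank hdim).nonempty
  have hw0 : w ≠ 0 := fun h => hw ⟨0, by simp [hH, h]⟩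
  have hq0 : q 0 = 0 := by simpa using hhom 0 0
  -- A zero with `‖c‖ < 1` would make a positive multiple of `w` a value of `H`, hence `w` itself by
  -- positive homogeneity. Thus `Y` avoids the origin on the ball and can be rescaled radially onto
  -- the level set.
  set Y : F → E := fun c => H c - (1 - ‖c‖) • w with hY
  have hYs : ∀ c ∈ sphere (0 : F) 1, Y c = x c := by
    intro c hc
    have : ‖c‖ = 1 := by simpa using hc
    simp [hY, hH, this]
  have hY0 : ∀ c ∈ closedBall (0 : F) 1, Y c ≠ 0 := by
    intro c hc h0
    have hc1 : ‖c‖ ≤ 1 := by simpa using hc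
    rcases hc1.eq_or_lt with h1 | h1
    · have hcs : c ∈ sphere (0 : F) 1 := by simpa using h1
      have := hxz c hcs
      rw [← hYs c hcs, h0, hq0] at this
      exact hz.ne this
    · have hs : 0 < 1 - ‖c‖ := by linarith
      refine hw ⟨(1 - ‖c‖)⁻¹ • c, ?_⟩
      have h2 : H c = (1 - ‖c‖) • w := sub_eq_zero.1 h0
      have h3 : ‖(1 - ‖c‖)⁻¹ • c‖ = (1 - ‖c‖)⁻¹ * ‖c‖ := by
        rw [norm_smul, norm_inv, Real.norm_of_nonneg hs.le]
      have h4 : H ((1 - ‖c‖)⁻¹ • c) = (1 - ‖c‖)⁻¹ • H c := by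
        simp only [hH, h3]
        rw [smul_smul, smul_smul, mul_inv, inv_inv, mul_right_comm, mul_inv_cancel₀ hs.ne', one_mul]
      rw [h4, h2, smul_smul, inv_mul_cancel₀ hs.ne', one_smul]
  have hYc : Continuous Y := hK'.continuous.sub ((continuous_const.sub continuous_norm).smul
    continuous_const)
  refine ⟨fun c => √(z / q (Y c)) • Y c, ?_, ?_, ?_⟩
  · refine ContinuousOn.smul (ContinuousOn.sqrt ?_) hYc.continuousOn
    exact continuousOn_const.div (hq.comp hYc).continuousOn fun c hc => (hpos _ (hY0 c hc)).ne'
  · intro c hc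
    have hp := hpos _ (hY0 c hc)
    rw [hhom, Real.sq_sqrt (by positivity), div_mul_cancel₀ _ hp.ne']
  · intro c hc
    simp only [hYs c hc, hxz c hc, div_self hz.ne', Real.sqrt_one, one_smul]

/-- A positive definite homogeneous function of degree two dominates a multiple of the square of
the norm. -/
theorem exists_norm_sq_le {E : Type*} [NormedAddCommGroup E] [NormedSpace ℝ E]
    [FiniteDimensional ℝ E] {q : E → ℝ} (hq : Continuous q)
    (hhom : ∀ (t : ℝ) (y : E), q (t • y) = t ^ 2 * q y) (hpos : ∀ y, y ≠ 0 → 0 < q y) :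
    ∃ δ > 0, ∀ y, δ * ‖y‖ ^ 2 ≤ q y := by
  have hq0 : q 0 = 0 := by simpa using hhom 0 0
  rcases subsingleton_or_nontrivial E with hE | hE
  · exact ⟨1, one_pos, fun y => by rw [Subsingleton.elim y 0, hq0]; simp⟩
  obtain ⟨u, hu⟩ := exists_norm_eq E zero_le_one
  obtain ⟨y₀, hy₀, hmin⟩ := (isCompact_sphere (0 : E) 1).exists_isMinOn ⟨u, by simpa using hu⟩
    hq.continuousOn
  have hy₀' : y₀ ≠ 0 := by
    rintro rfl
    simp at hy₀
  refine ⟨q y₀, hpos _ hy₀', fun y => ?_⟩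
  rcases eq_or_ne y 0 with rfl | hy
  · simp [hq0]
  have hn : ‖y‖ ≠ 0 := norm_ne_zero_iff.2 hy
  have h1 : q y₀ ≤ q (‖y‖⁻¹ • y) := hmin (by simpa using norm_smul_inv_norm (𝕜 := ℝ) hy)
  have h2 : q y = ‖y‖ ^ 2 * q (‖y‖⁻¹ • y) := by
    rw [← hhom, smul_smul, mul_inv_cancel₀ hn, one_smul]
  rw [h2, mul_comm]
  gcongr

end Extension

/-! ### Quadratic forms, generalized eigenvalues and the Lagrange multiplier. -/

section QuadraticForms

variable {𝕜 : Type*} [RCLike 𝕜] {m n : ℕ}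

/-- The real inner product `Re (x^* y)`. -/
def reDot (x y : Fin n → 𝕜) : ℝ := RCLike.re (star x ⬝ᵥ y)

theorem normSqOf_eq_reDot (M : Matrix (Fin n) (Fin n) 𝕜) (x : Fin n → 𝕜) :
    normSqOf M x = reDot x (M *ᵥ x) := rfl

theorem reDot_comm (x y : Fin n → 𝕜) : reDot x y = reDot y x := by
  unfold reDot
  rw [← RCLike.conj_re (star x ⬝ᵥ y), starRingEnd_apply, ← Matrix.star_dotProduct_star, star_star,
    dotProduct_comm]

theorem reDot_add_left (x y w : Fin n → 𝕜) : reDot (x + y) w = reDot x w + reDot y w := by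
  simp [reDot, add_dotProduct]

theorem reDot_sub_left (x y w : Fin n → 𝕜) : reDot (x - y) w = reDot x w - reDot y w := by
  simp [reDot, sub_dotProduct]

theorem reDot_add_right (x y w : Fin n → 𝕜) : reDot x (y + w) = reDot x y + reDot x w := by
  simp [reDot, dotProduct_add]

theorem reDot_sub_right (x y w : Fin n → 𝕜) : reDot x (y - w) = reDot x y - reDot x w := by
  simp [reDot, dotProduct_sub]

theorem reDot_ofReal_smul_right (r : ℝ) (x y : Fin n → 𝕜) :
    reDot x ((r : 𝕜) • y) = r * reDot x y := by
  simp [reDot, dotProduct_smul, RCLike.smul_re]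

theorem reDot_sum_right {ι : Type*} (s : Finset ι) (x : Fin n → 𝕜) (y : ι → Fin n → 𝕜) :
    reDot x (∑ i ∈ s, y i) = ∑ i ∈ s, reDot x (y i) := by
  simp [reDot, dotProduct_sum]

theorem reDot_mulVec_comm {M : Matrix (Fin n) (Fin n) 𝕜} (hM : M.IsHermitian) (x y : Fin n → 𝕜) :
    reDot x (M *ᵥ y) = reDot y (M *ᵥ x) := by
  rw [reDot_comm y]
  unfold reDot
  rw [Matrix.star_mulVec, hM.eq, Matrix.dotProduct_mulVec]

theorem normSqOf_add_matrix (M N : Matrix (Fin n) (Fin n) 𝕜) (x : Fin n → 𝕜) :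
    normSqOf (M + N) x = normSqOf M x + normSqOf N x := by
  simp only [normSqOf_eq_reDot, Matrix.add_mulVec, reDot_add_right]

theorem normSqOf_sub_matrix (M N : Matrix (Fin n) (Fin n) 𝕜) (x : Fin n → 𝕜) :
    normSqOf (M - N) x = normSqOf M x - normSqOf N x := by
  simp only [normSqOf_eq_reDot, Matrix.sub_mulVec, reDot_sub_right]

theorem normSqOf_smul_matrix (r : ℝ) (M : Matrix (Fin n) (Fin n) 𝕜) (x : Fin n → 𝕜) :
    normSqOf ((r : 𝕜) • M) x = r * normSqOf M x := by
  simp only [normSqOf_eq_reDot, Matrix.smul_mulVec, reDot_ofReal_smul_right]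

theorem normSqOf_smul (M : Matrix (Fin n) (Fin n) 𝕜) (r : ℝ) (x : Fin n → 𝕜) :
    normSqOf M (r • x) = r ^ 2 * normSqOf M x := by
  simp [normSqOf, Matrix.mulVec_smul, RCLike.smul_re, pow_two, mul_assoc]

theorem normSqOf_zero (M : Matrix (Fin n) (Fin n) 𝕜) : normSqOf M 0 = 0 := by
  simp [normSqOf]

theorem normSqOf_add {M : Matrix (Fin n) (Fin n) 𝕜} (hM : M.IsHermitian) (x y : Fin n → 𝕜) :
    normSqOf M (x + y) = normSqOf M x + 2 * reDot y (M *ᵥ x) + normSqOf M y := by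
  simp only [normSqOf_eq_reDot, Matrix.mulVec_add, reDot_add_left, reDot_add_right]
  rw [reDot_mulVec_comm hM x y]
  ring

theorem continuous_normSqOf (M : Matrix (Fin n) (Fin n) 𝕜) : Continuous (normSqOf M) := by
  unfold normSqOf
  fun_prop

theorem normSqOf_pos {P : Matrix (Fin n) (Fin n) 𝕜} (hP : P.PosDef) {x : Fin n → 𝕜} (hx : x ≠ 0) :
    0 < normSqOf P x :=
  (RCLike.pos_iff.1 (hP.dotProduct_mulVec_pos hx)).1

theorem normSqOf_nonneg {P : Matrix (Fin n) (Fin n) 𝕜} (hP : P.PosDef) (x : Fin n → 𝕜) :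
    0 ≤ normSqOf P x :=
  (RCLike.nonneg_iff.1 (hP.posSemidef.dotProduct_mulVec_nonneg x)).1

/-- The norm on `Fin n → 𝕜` is the sup norm, which the Euclidean norm dominates. -/
theorem norm_sq_le_normSqOf_one (x : Fin n → 𝕜) :
    ‖x‖ ^ 2 ≤ normSqOf (1 : Matrix (Fin n) (Fin n) 𝕜) x := by
  have h : normSqOf (1 : Matrix (Fin n) (Fin n) 𝕜) x = ∑ i, ‖x i‖ ^ 2 := by
    simp only [normSqOf, Matrix.one_mulVec, dotProduct, Pi.star_apply, map_sum]
    refine Finset.sum_congr rfl fun i _ => ?_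
    rw [RCLike.star_def, RCLike.conj_mul, ← RCLike.ofReal_pow, RCLike.ofReal_re]
  have h0 : 0 ≤ ∑ i, ‖x i‖ ^ 2 := Finset.sum_nonneg fun i _ => by positivity
  rw [h]
  refine (Real.le_sqrt (norm_nonneg _) h0).1 ((pi_norm_le_iff_of_nonneg (Real.sqrt_nonneg _)).2 ?_)
  intro i
  refine (Real.le_sqrt (norm_nonneg _) h0).2 ?_
  exact Finset.single_le_sum (f := fun i => ‖x i‖ ^ 2) (fun i _ => by positivity)
    (Finset.mem_univ i)

theorem isCompact_normSqOf_le {P : Matrix (Fin n) (Fin n) 𝕜} (hP : P.PosDef) (z : ℝ) :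
    IsCompact {y : Fin n → 𝕜 | normSqOf P y ≤ z} := by
  obtain ⟨δ, hδ, hle⟩ := exists_norm_sq_le (continuous_normSqOf P) (normSqOf_smul P)
    fun y hy => normSqOf_pos hP hy
  refine Metric.isCompact_of_isClosed_isBounded
    (isClosed_le (continuous_normSqOf P) continuous_const) ?_
  refine (Metric.isBounded_iff_subset_closedBall 0).2 ⟨√(z / δ), fun y hy => ?_⟩
  rw [mem_closedBall_zero_iff]
  refine Real.le_sqrt_of_sq_le ?_
  rw [le_div_iff₀ hδ, mul_comm]
  exact (hle y).trans hy

theorem isHermitian_ofReal_smul (r : ℝ) {M : Matrix (Fin n) (Fin n) 𝕜} (hM : M.IsHermitian) :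
    ((r : 𝕜) • M).IsHermitian := by
  rw [Matrix.IsHermitian, Matrix.conjTranspose_smul, hM.eq, RCLike.star_def, RCLike.conj_ofReal]

/-- The smallest generalized eigenvalue is a lower bound of the generalized Rayleigh quotient. -/
theorem minGenEig_mul_le {P M : Matrix (Fin n) (Fin n) 𝕜} (hP : P.PosDef) (hM : M.IsHermitian)
    (y : Fin n → 𝕜) : minGenEig P M * normSqOf P y ≤ normSqOf M y := by
  rcases subsingleton_or_nontrivial (Fin n → 𝕜) with hE | hE
  · rw [Subsingleton.elim y 0, normSqOf_zero, normSqOf_zero, mul_zero]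
  obtain ⟨u, hu⟩ := exists_norm_eq (Fin n → 𝕜) zero_le_one
  have hne : ∀ y ∈ Metric.sphere (0 : Fin n → 𝕜) 1, y ≠ 0 := by
    rintro y hy rfl
    simp at hy
  obtain ⟨y₀, hy₀, hmin⟩ := (isCompact_sphere (0 : Fin n → 𝕜) 1).exists_isMinOn
    ⟨u, by simpa using hu⟩ ((continuous_normSqOf M).continuousOn.div
      (continuous_normSqOf P).continuousOn fun y hy => (normSqOf_pos hP (hne y hy)).ne')
  set μ : ℝ := normSqOf M y₀ / normSqOf P y₀ with hμ
  have hP₀ := normSqOf_pos hP (hne y₀ hy₀)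
  have hle : ∀ y, μ * normSqOf P y ≤ normSqOf M y := by
    intro y
    rcases eq_or_ne y 0 with rfl | hy
    · rw [normSqOf_zero, normSqOf_zero, mul_zero]
    have hn : ‖y‖⁻¹ ≠ 0 := inv_ne_zero (norm_ne_zero_iff.2 hy)
    have h1 : μ ≤ normSqOf M (‖y‖⁻¹ • y) / normSqOf P (‖y‖⁻¹ • y) :=
      hmin (by simp [norm_smul, norm_ne_zero_iff.2 hy])
    rw [normSqOf_smul, normSqOf_smul, mul_div_mul_left _ _ (pow_ne_zero 2 hn)] at h1
    exact (le_div_iff₀ (normSqOf_pos hP hy)).1 h1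
  have hherm : (M - (μ : 𝕜) • P).IsHermitian :=
    hM.sub (isHermitian_ofReal_smul μ hP.isHermitian)
  have hpsd : (M - (μ : 𝕜) • P).PosSemidef := by
    refine Matrix.PosSemidef.of_dotProduct_mulVec_nonneg hherm fun x => ?_
    rw [RCLike.nonneg_iff]
    refine ⟨?_, hherm.im_star_dotProduct_mulVec_self x⟩
    change 0 ≤ normSqOf (M - (μ : 𝕜) • P) x
    rw [normSqOf_sub_matrix, normSqOf_smul_matrix, sub_nonneg]
    exact hle x
  -- The minimum `μ` of the Rayleigh quotient makes `M - μP` positive semidefinite, and a zero of a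
  -- semidefinite form lies in the kernel, so the minimizer is an eigenvector.
  have hleast : IsLeast {l : ℝ | ∃ x : Fin n → 𝕜, x ≠ 0 ∧ (M - (l : 𝕜) • P) *ᵥ x = 0} μ := by
    refine ⟨⟨y₀, hne y₀ hy₀, ?_⟩, ?_⟩
    · rw [← hpsd.dotProduct_mulVec_zero_iff]
      refine RCLike.ext ?_ ?_
      · change normSqOf (M - (μ : 𝕜) • P) y₀ = _
        rw [normSqOf_sub_matrix, normSqOf_smul_matrix, hμ, div_mul_cancel₀ _ hP₀.ne', sub_self,
          map_zero]
      · rw [hherm.im_star_dotProduct_mulVec_self, map_zero]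
    · rintro l ⟨x, hx, hx0⟩
      have h1 : normSqOf (M - (l : 𝕜) • P) x = 0 := by
        rw [normSqOf, hx0, dotProduct_zero, map_zero]
      rw [normSqOf_sub_matrix, normSqOf_smul_matrix, sub_eq_zero] at h1
      have h2 := hle x
      rw [h1] at h2
      exact le_of_mul_le_mul_right h2 (normSqOf_pos hP hx)
  rw [minGenEig, hleast.csInf_eq]
  exact hle y

theorem posDef_of_normSqOf_pos {M : Matrix (Fin n) (Fin n) 𝕜} (hM : M.IsHermitian)
    (h : ∀ x, x ≠ 0 → 0 < normSqOf M x) : M.PosDef :=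
  Matrix.PosDef.of_dotProduct_mulVec_pos hM fun x hx =>
    RCLike.pos_iff.2 ⟨h x hx, hM.im_star_dotProduct_mulVec_self x⟩

/-- Completing the square. -/
theorem normSqOf_sub_two_mul_reDot {Q : Matrix (Fin n) (Fin n) 𝕜} (hQ : Q.IsHermitian)
    {y b : Fin n → 𝕜} (hy : Q *ᵥ y = b) (u : Fin n → 𝕜) :
    normSqOf Q u - 2 * reDot u b = normSqOf Q y - 2 * reDot y b + normSqOf Q (u - y) := by
  have h1 := normSqOf_add hQ y (u - y)
  rw [add_sub_cancel, hy, reDot_sub_left] at h1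
  have h2 : normSqOf Q y = reDot y b := by rw [normSqOf_eq_reDot, hy]
  linarith

/-- The Lagrange multiplier for the level set `|y|_P ^ 2 = z`, when the unconstrained solution
`T⁻¹ b` lies outside of it. -/
theorem exists_multiplier {P T : Matrix (Fin n) (Fin n) 𝕜} (hP : P.PosDef) (hT : T.PosDef)
    (b : Fin n → 𝕜) {z : ℝ} (hz : 0 < z) (hzT : z ≤ normSqOf P (T⁻¹ *ᵥ b)) :
    ∃ s : ℝ, 0 ≤ s ∧ ∃ y, (T + (s : 𝕜) • P) *ᵥ y = b ∧ normSqOf P y = z := by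
  have hQ : ∀ s : ℝ, 0 ≤ s → (T + (s : 𝕜) • P).PosDef := by
    intro s hs
    refine posDef_of_normSqOf_pos (hT.isHermitian.add (isHermitian_ofReal_smul s hP.isHermitian))
      fun x hx => ?_
    rw [normSqOf_add_matrix, normSqOf_smul_matrix]
    have := mul_nonneg hs (normSqOf_nonneg hP x)
    linarith [normSqOf_pos hT hx]
  have hsol : ∀ Q : Matrix (Fin n) (Fin n) 𝕜, Q.PosDef → Q *ᵥ (Q⁻¹ *ᵥ b) = b := fun Q hQ => by
    rw [Matrix.mulVec_mulVec, Matrix.mul_nonsing_inv _ ((Matrix.isUnit_iff_isUnit_det _).1 hQ.isUnit),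
      Matrix.one_mulVec]
  set h : ℝ → ℝ := fun s => normSqOf P ((T + (s : 𝕜) • P)⁻¹ *ᵥ b) with hh
  have hcont : ContinuousOn h (Set.Ici 0) := by
    intro s hs
    refine ContinuousAt.continuousWithinAt ?_
    have hdet : (T + (s : 𝕜) • P).det ≠ 0 :=
      ((Matrix.isUnit_iff_isUnit_det _).1 (hQ s hs).isUnit).ne_zero
    have hinv : ContinuousAt (fun s : ℝ => (T + (s : 𝕜) • P)⁻¹) s := by
      have hc : Continuous fun s : ℝ => T + (s : 𝕜) • P :=
        continuous_const.add (Continuous.smul (f := fun s : ℝ => (s : 𝕜)) (g := fun _ => P)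
          RCLike.continuous_ofReal continuous_const)
      simp only [Matrix.inv_def, Ring.inverse_eq_inv']
      exact (hc.matrix_det.continuousAt.inv₀ hdet).smul hc.matrix_adjugate.continuousAt
    have hmul : Continuous fun R : Matrix (Fin n) (Fin n) 𝕜 => R *ᵥ b :=
      continuous_id.matrix_mulVec continuous_const
    exact ((continuous_normSqOf P).comp hmul).continuousAt.comp hinv
  set κ : ℝ := normSqOf P (P⁻¹ *ᵥ b) with hκ
  have hκ0 : 0 ≤ κ := normSqOf_nonneg hP _
  -- Pairing `(T + sP) y = b` with `y`, and using `2 Re(y^* b) ≤ |y|_P² + κ`, shows that the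
  -- solution tends to zero as `s` grows.
  have hbound : ∀ s : ℝ, 0 ≤ s → (2 * s - 1) * h s ≤ κ := by
    intro s hs
    set y := (T + (s : 𝕜) • P)⁻¹ *ᵥ b with hy
    have h1 : normSqOf T y + s * normSqOf P y = reDot y b := by
      rw [← normSqOf_smul_matrix, ← normSqOf_add_matrix, normSqOf_eq_reDot, hsol _ (hQ s hs)]
    have h2 := normSqOf_sub_two_mul_reDot hP.isHermitian (hsol P hP) y
    have h3 : reDot (P⁻¹ *ᵥ b) b = κ := by rw [hκ, normSqOf_eq_reDot, hsol P hP]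
    have h4 := normSqOf_nonneg hP (y - P⁻¹ *ᵥ b)
    have h5 := normSqOf_nonneg hT y
    change (2 * s - 1) * normSqOf P y ≤ κ
    linarith
  -- Chosen so that `(2 s₁ - 1) z = κ + 2z ≥ κ`, which gives `h s₁ ≤ z`; the intermediate value
  -- theorem then applies on `[0, s₁]`.
  set s₁ : ℝ := (κ / z + 1) / 2 + 1 with hs₁
  have hs₁0 : 0 ≤ s₁ := by positivity
  have hs₁z : h s₁ ≤ z := by
    have h1 := hbound s₁ hs₁0
    have h2 : (0 : ℝ) < 2 * s₁ - 1 := by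
      have : 0 ≤ κ / z := by positivity
      rw [hs₁]; linarith
    refine le_of_mul_le_mul_left (h1.trans ?_) h2
    have h3 : (2 * s₁ - 1) * z = κ + 2 * z := by
      rw [hs₁]; field_simp; ring
    linarith
  have h0z : z ≤ h 0 := by simpa [hh] using hzT
  obtain ⟨s, hs, hsz⟩ := intermediate_value_Icc' hs₁0 (hcont.mono Set.Icc_subset_Ici_self)
    ⟨hs₁z, h0z⟩
  exact ⟨s, hs.1, _, hsol _ (hQ s hs.1), hsz⟩

end QuadraticForms

/-! ### The quadratic map, its penalized minimizers and the dimension count. -/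

section QuadraticMap

variable {𝕜 : Type*} [RCLike 𝕜] {m n : ℕ}

theorem isHermitian_combMat {A : Fin m → Matrix (Fin n) (Fin n) 𝕜} (hA : ∀ i, (A i).IsHermitian)
    (c : Fin m → ℝ) : (combMat c A).IsHermitian := by
  rw [Matrix.IsHermitian, combMat, Matrix.conjTranspose_sum]
  exact Finset.sum_congr rfl fun i _ => isHermitian_ofReal_smul (c i) (hA i)

theorem combVec_sub_mulVec (c : Fin m → ℝ) (A : Fin m → Matrix (Fin n) (Fin n) 𝕜)
    (v : Fin m → Fin n → 𝕜) (x : Fin n → 𝕜) :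
    combVec c (fun i => v i - A i *ᵥ x) = combVec c v - combMat c A *ᵥ x := by
  simp only [combVec, combMat, smul_sub, Finset.sum_sub_distrib, Matrix.sum_mulVec,
    Matrix.smul_mulVec]

theorem combVec_add (c d : Fin m → ℝ) (v : Fin m → Fin n → 𝕜) :
    combVec (c + d) v = combVec c v + combVec d v := by
  simp only [combVec, Pi.add_apply, RCLike.ofReal_add, add_smul, Finset.sum_add_distrib]

theorem combVec_smul (r : ℝ) (c : Fin m → ℝ) (v : Fin m → Fin n → 𝕜) :
    combVec (r • c) v = r • combVec c v := by
  ext j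
  simp only [combVec, Pi.smul_apply, Finset.sum_apply, smul_eq_mul, RCLike.ofReal_mul,
    Finset.smul_sum, RCLike.real_smul_eq_coe_mul, mul_assoc]

theorem dot_quadMap (A : Fin m → Matrix (Fin n) (Fin n) 𝕜) (v : Fin m → Fin n → 𝕜)
    (f0 : Fin m → ℝ) (c : Fin m → ℝ) (x : Fin n → 𝕜) :
    c ⬝ᵥ quadMap A v f0 x
      = normSqOf (combMat c A) x - 2 * reDot x (combVec c v) + c ⬝ᵥ f0 := by
  have h1 : normSqOf (combMat c A) x = ∑ i, c i * reDot x (A i *ᵥ x) := by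
    rw [normSqOf_eq_reDot, combMat, Matrix.sum_mulVec, reDot_sum_right]
    refine Finset.sum_congr rfl fun i _ => ?_
    rw [Matrix.smul_mulVec, reDot_ofReal_smul_right]
  have h2 : reDot x (combVec c v) = ∑ i, c i * reDot x (v i) := by
    rw [combVec, reDot_sum_right]
    exact Finset.sum_congr rfl fun i _ => reDot_ofReal_smul_right _ _ _
  have h3 : ∀ i, quadMap A v f0 x i = reDot x (A i *ᵥ x) - 2 * reDot x (v i) + f0 i := by
    intro i
    have : reDot (v i) x = reDot x (v i) := reDot_comm _ _
    unfold quadMap reDot at *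
    rw [map_sub, map_sub, this]
    ring
  rw [h1, h2, dotProduct, dotProduct, Finset.mul_sum, ← Finset.sum_sub_distrib,
    ← Finset.sum_add_distrib]
  refine Finset.sum_congr rfl fun i _ => ?_
  rw [h3]
  ring

theorem dot_quadMap_add {A : Fin m → Matrix (Fin n) (Fin n) 𝕜} (hA : ∀ i, (A i).IsHermitian)
    (v : Fin m → Fin n → 𝕜) (f0 : Fin m → ℝ) (c : Fin m → ℝ) (x y : Fin n → 𝕜) :
    c ⬝ᵥ quadMap A v f0 (x + y) = c ⬝ᵥ quadMap A v f0 x + (normSqOf (combMat c A) y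
      - 2 * reDot y (combVec c fun i => v i - A i *ᵥ x)) := by
  rw [dot_quadMap, dot_quadMap, combVec_sub_mulVec, normSqOf_add (isHermitian_combMat hA c),
    reDot_add_left, reDot_sub_right]
  ring

/-- The base point solves `A₊ x₀ = c₊ · v`, so the linear term of `c₊ · f` at `x₀` vanishes. -/
theorem dot_quadMap_basePoint_add {A : Fin m → Matrix (Fin n) (Fin n) 𝕜}
    (hA : ∀ i, (A i).IsHermitian) (v : Fin m → Fin n → 𝕜) (f0 : Fin m → ℝ) {cp : Fin m → ℝ}
    (hpos : (combMat cp A).PosDef) (y : Fin n → 𝕜) :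
    cp ⬝ᵥ quadMap A v f0 (basePoint A v cp + y)
      = cp ⬝ᵥ quadMap A v f0 (basePoint A v cp) + normSqOf (combMat cp A) y := by
  have h : combMat cp A *ᵥ basePoint A v cp = combVec cp v := by
    rw [basePoint, Matrix.mulVec_mulVec,
      Matrix.mul_nonsing_inv _ ((Matrix.isUnit_iff_isUnit_det _).1 hpos.isUnit), Matrix.one_mulVec]
  rw [dot_quadMap_add hA, combVec_sub_mulVec, h, sub_self]
  simp [reDot]

theorem contDiff_quadMap (A : Fin m → Matrix (Fin n) (Fin n) 𝕜) (v : Fin m → Fin n → 𝕜)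
    (f0 : Fin m → ℝ) : ContDiff ℝ 1 (quadMap A v f0) := by
  have hstar : ContDiff ℝ 1 (fun x : 𝕜 => star x) := (RCLike.conjCLE (K := 𝕜)).contDiff
  have hre : ContDiff ℝ 1 (fun x : 𝕜 => RCLike.re x) := (RCLike.reCLM (K := 𝕜)).contDiff
  have hcoord : ∀ j, ContDiff ℝ 1 (fun x : Fin n → 𝕜 => x j) := fun j => contDiff_apply ℝ 𝕜 j
  refine contDiff_pi.2 fun i => ?_
  simp only [quadMap, dotProduct, Matrix.mulVec, Pi.star_apply]
  refine (hre.comp (ContDiff.sub (ContDiff.sub ?_ ?_) ?_)).add contDiff_const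
  · exact ContDiff.sum fun j _ => (hstar.comp (hcoord j)).mul
      (ContDiff.sum fun k _ => contDiff_const.mul (hcoord k))
  · exact ContDiff.sum fun j _ => contDiff_const.mul (hcoord j)
  · exact ContDiff.sum fun j _ => (hstar.comp (hcoord j)).mul contDiff_const

/-- On the level set `|y|₊ ^ 2 = z` the penalized function `c · f + ε |y| ^ 2` has a minimizer with
quadratic growth, as long as `z` does not exceed the minimized quantity. -/
theorem exists_penalized_minimizer {A : Fin m → Matrix (Fin n) (Fin n) 𝕜}
    (hA : ∀ i, (A i).IsHermitian) (v : Fin m → Fin n → 𝕜) (f0 : Fin m → ℝ) {cp : Fin m → ℝ}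
    (hpos : (combMat cp A).PosDef) {ε z : ℝ} (hε : 0 < ε) (hz : 0 < z) {c : Fin m → ℝ}
    (hc : z ≤ objective A v cp ε c) :
    ∃ (y : Fin n → 𝕜) (l : ℝ), normSqOf (combMat cp A) y = z ∧ ∀ u : Fin n → 𝕜,
      c ⬝ᵥ quadMap A v f0 (basePoint A v cp + y) + ε * normSqOf 1 y - l * z
          + ε * normSqOf 1 (u - y)
        ≤ c ⬝ᵥ quadMap A v f0 (basePoint A v cp + u) + ε * normSqOf 1 u
          - l * normSqOf (combMat cp A) u := by
  set P := combMat cp A with hP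
  set lam := minGenEig P (combMat c A) with hlam
  set T : Matrix (Fin n) (Fin n) 𝕜 := combMat c A - (lam : 𝕜) • P + (ε : 𝕜) • 1 with hT
  have hone : (1 : Matrix (Fin n) (Fin n) 𝕜).IsHermitian := Matrix.isHermitian_one
  have hTh : T.IsHermitian := ((isHermitian_combMat hA c).sub
    (isHermitian_ofReal_smul lam hpos.isHermitian)).add (isHermitian_ofReal_smul ε hone)
  have hTn : ∀ u, normSqOf T u = normSqOf (combMat c A) u - lam * normSqOf P u
      + ε * normSqOf 1 u := fun u => by
    rw [hT, normSqOf_add_matrix, normSqOf_sub_matrix, normSqOf_smul_matrix, normSqOf_smul_matrix]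
  have hTle : ∀ u, ε * normSqOf 1 u ≤ normSqOf T u := fun u => by
    rw [hTn]
    linarith [minGenEig_mul_le hpos (isHermitian_combMat hA c) u]
  have hTpos : T.PosDef := posDef_of_normSqOf_pos hTh fun u hu =>
    (mul_pos hε (normSqOf_pos Matrix.PosDef.one hu)).trans_le (hTle u)
  set b := combVec c (fun i => v i - A i *ᵥ basePoint A v cp) with hb
  obtain ⟨s, hs, y, hy, hyz⟩ := exists_multiplier hpos hTpos b hz hc
  -- With this multiplier the Lagrangian has quadratic part `T + sP`, where `s ≥ 0` and `T`
  -- dominates `ε`; completing the square at `y` leaves a growth of at least `ε|u - y|²`.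
  refine ⟨y, lam - s, hyz, fun u => ?_⟩
  have hQ : (T + (s : 𝕜) • P).IsHermitian := hTh.add (isHermitian_ofReal_smul s hpos.isHermitian)
  have hsq := normSqOf_sub_two_mul_reDot hQ hy u
  simp only [normSqOf_add_matrix T, normSqOf_smul_matrix s] at hsq
  have h1 := hTle (u - y)
  have h2 := mul_nonneg hs (normSqOf_nonneg hpos (u - y))
  rw [hTn u, hTn y, hyz] at hsq
  rw [dot_quadMap_add hA, dot_quadMap_add hA]
  linarith

/-- The space of coefficient vectors orthogonal to `cp`. -/
noncomputable abbrev coeffSpace (cp : Fin m → ℝ) : Submodule ℝ (EuclideanSpace ℝ (Fin m)) :=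
  (ℝ ∙ WithLp.toLp 2 cp)ᗮ

theorem inner_eq_dot (c d : EuclideanSpace ℝ (Fin m)) : inner ℝ c d = c.ofLp ⬝ᵥ d.ofLp := by
  rw [EuclideanSpace.inner_eq_star_dotProduct, dotProduct_comm]
  simp

theorem mem_coeffSpace {cp : Fin m → ℝ} {c : EuclideanSpace ℝ (Fin m)} :
    c ∈ coeffSpace cp ↔ c.ofLp ⬝ᵥ cp = 0 := by
  rw [coeffSpace, Submodule.mem_orthogonal_singleton_iff_inner_left, inner_eq_dot]

theorem finrank_coeffSpace {cp : Fin m → ℝ} (hcp : cp ≠ 0) :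
    Module.finrank ℝ (coeffSpace cp) + 1 = m := by
  have h := Submodule.finrank_add_finrank_orthogonal (ℝ ∙ (WithLp.toLp 2 cp))
  rw [finrank_span_singleton (by simpa using hcp), finrank_euclideanSpace_fin] at h
  exact (add_comm _ _).trans h

theorem zMax_eq_zero {A : Fin m → Matrix (Fin n) (Fin n) 𝕜} {v : Fin m → Fin n → 𝕜}
    {cp c : Fin m → ℝ} (hc : c ⬝ᵥ c = 1) (hcp : c ⬝ᵥ cp = 0)
    (h : combVec c (fun i => v i - A i *ᵥ basePoint A v cp) = 0) : zMax A v cp = 0 := by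
  have h1 : ∀ ε, minObjective A v cp ε = 0 := by
    intro ε
    have h2 : objective A v cp ε c = 0 := by
      rw [objective, h, Matrix.mulVec_zero, normSqOf_zero]
    refine le_antisymm ?_ zero_le
    refine (iInf₂_le (i := c) ⟨hc, hcp⟩).trans ?_
    rw [h2, ENNReal.ofReal_zero]
  simp [zMax, h1]

/-- If `zMax` is positive and the dimension is not the exceptional one, then the coefficient space
has smaller dimension than the domain. -/
theorem finrank_coeffSpace_lt {A : Fin m → Matrix (Fin n) (Fin n) 𝕜} {v : Fin m → Fin n → 𝕜}
    {cp : Fin m → ℝ} (hcp : cp ≠ 0) (hdim : Module.finrank ℝ (Fin n → 𝕜) + 1 ≠ m)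
    (hz : zMax A v cp ≠ 0) :
    Module.finrank ℝ (coeffSpace cp) < Module.finrank ℝ (Fin n → 𝕜) := by
  let w : Fin m → Fin n → 𝕜 := fun i => v i - A i *ᵥ basePoint A v cp
  let B : coeffSpace cp →ₗ[ℝ] (Fin n → 𝕜) :=
    { toFun := fun c => combVec (c : EuclideanSpace ℝ (Fin m)).ofLp w
      map_add' := fun c d => combVec_add _ _ _
      map_smul' := fun r c => combVec_smul _ _ _ }
  -- A kernel vector, normalized, would make the minimized quantity zero for every `ε`. Injectivity
  -- gives `m - 1 ≤ dim V`, and `hdim` excludes equality.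
  have hB : Function.Injective B := by
    refine (injective_iff_map_eq_zero B).2 fun c hc => ?_
    by_contra hne
    have hn : ‖c‖ ≠ 0 := norm_ne_zero_iff.2 hne
    set d := ‖c‖⁻¹ • c with hd
    have hd1 : ‖d‖ = 1 := norm_smul_inv_norm (𝕜 := ℝ) hne
    have hBd : B d = 0 := by rw [hd, map_smul, hc, smul_zero]
    refine hz (zMax_eq_zero (c := (d : EuclideanSpace ℝ (Fin m)).ofLp) ?_
      (mem_coeffSpace.1 d.2) hBd)
    rw [← inner_eq_dot, real_inner_self_eq_norm_sq, Submodule.norm_coe, hd1, one_pow]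
  have h1 := LinearMap.finrank_le_finrank_of_injective hB
  have h2 := finrank_coeffSpace hcp
  omega

end QuadraticMap

/-! ### From approximate solutions to convexity. -/

section Convexity

open Metric

variable {𝕜 : Type*} [RCLike 𝕜] {m n : ℕ}

theorem exists_lipschitzOnWith_quadMap (A : Fin m → Matrix (Fin n) (Fin n) 𝕜)
    (v : Fin m → Fin n → 𝕜) (f0 : Fin m → ℝ) (x₀ : Fin n → 𝕜) {S : Set (Fin n → 𝕜)}
    (hS : IsCompact S) :
    ∃ L : NNReal, LipschitzOnWith L
      (fun y => (WithLp.toLp 2 (quadMap A v f0 (x₀ + y)) : EuclideanSpace ℝ (Fin m))) S := by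
  have h : ContDiff ℝ 1
      (fun y => (WithLp.toLp 2 (quadMap A v f0 (x₀ + y)) : EuclideanSpace ℝ (Fin m))) :=
    (PiLp.continuousLinearEquiv 2 ℝ (fun _ : Fin m => ℝ)).symm.contDiff.comp
      ((contDiff_quadMap A v f0).comp (contDiff_const.add contDiff_id))
  exact h.locallyLipschitz.locallyLipschitzOn.exists_lipschitzOnWith_of_compact hS

/-- A convex combination `p` of two values of `f` is attained on the level set `|y|₊ ^ 2 = z` up to
an error of order `ε`. -/
theorem exists_dist_quadMap_le {A : Fin m → Matrix (Fin n) (Fin n) 𝕜}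
    (hA : ∀ i, (A i).IsHermitian) (v : Fin m → Fin n → 𝕜) (f0 : Fin m → ℝ) {cp : Fin m → ℝ}
    (hpos : (combMat cp A).PosDef)
    (hlt : Module.finrank ℝ (coeffSpace cp) < Module.finrank ℝ (Fin n → 𝕜))
    {ε z : ℝ} (hε : 0 < ε) (hz : 0 < z)
    (hobj : ∀ c : Fin m → ℝ, c ⬝ᵥ c = 1 → c ⬝ᵥ cp = 0 → z ≤ objective A v cp ε c)
    {y₁ y₂ : Fin n → 𝕜} {a b : ℝ} (ha : 0 ≤ a) (hb : 0 ≤ b) (hab : a + b = 1)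
    (hyz : a * normSqOf (combMat cp A) y₁ + b * normSqOf (combMat cp A) y₂ = z) :
    ∃ y, normSqOf (combMat cp A) y = z ∧
      ‖(WithLp.toLp 2 (quadMap A v f0 (basePoint A v cp + y)
        - (a • quadMap A v f0 (basePoint A v cp + y₁)
          + b • quadMap A v f0 (basePoint A v cp + y₂))) : EuclideanSpace ℝ (Fin m))‖
        ≤ ε * (a * normSqOf (1 : Matrix (Fin n) (Fin n) 𝕜) y₁
          + b * normSqOf (1 : Matrix (Fin n) (Fin n) 𝕜) y₂) := by
  set P := combMat cp A with hP
  set x₀ := basePoint A v cp with hx₀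
  set f := quadMap A v f0 with hf
  set p := a • f (x₀ + y₁) + b • f (x₀ + y₂) with hp
  set N : (Fin n → 𝕜) → ℝ := normSqOf (1 : Matrix (Fin n) (Fin n) 𝕜) with hN
  set R := a * N y₁ + b * N y₂ with hR
  have hN0 : ∀ u, 0 ≤ N u := fun u => normSqOf_nonneg Matrix.PosDef.one u
  have hR0 : 0 ≤ R := by have := hN0 y₁; have := hN0 y₂; positivity
  set φ : (Fin n → 𝕜) → EuclideanSpace ℝ (Fin m) := fun y => WithLp.toLp 2 (f (x₀ + y)) with hφ
  have hS : IsCompact {y : Fin n → 𝕜 | normSqOf P y = z} :=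
    (isCompact_normSqOf_le hpos z).of_isClosed_subset
      (isClosed_eq (continuous_normSqOf P) continuous_const) fun y hy => le_of_eq hy
  obtain ⟨L, hL⟩ := exists_lipschitzOnWith_quadMap A v f0 x₀ hS
  have hφc : Continuous φ := (PiLp.continuous_toLp 2 _).comp
    ((contDiff_quadMap A v f0).continuous.comp (continuous_const.add continuous_id))
  have hex : ∀ c : coeffSpace cp, c ∈ sphere (0 : coeffSpace cp) 1 →
      ∃ (y : Fin n → 𝕜) (l : ℝ), normSqOf P y = z ∧ ∀ u,
        (c : EuclideanSpace ℝ (Fin m)).ofLp ⬝ᵥ f (x₀ + y) + ε * N y - l * z + ε * N (u - y)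
          ≤ (c : EuclideanSpace ℝ (Fin m)).ofLp ⬝ᵥ f (x₀ + u) + ε * N u - l * normSqOf P u := by
    intro c hc
    refine exists_penalized_minimizer hA v f0 hpos hε hz (hobj _ ?_ (mem_coeffSpace.1 c.2))
    have hc1 : ‖c‖ = 1 := by simpa using hc
    rw [← inner_eq_dot, real_inner_self_eq_norm_sq, Submodule.norm_coe, hc1, one_pow]
  choose! x l hxz hxl using hex
  have hxLip : LipschitzOnWith (L / (2 * ε.toNNReal)) x (sphere 0 1) := by
    refine LipschitzOnWith.of_dist_le_mul fun c hc d hd => ?_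
    rw [dist_eq_norm, dist_eq_norm]
    have h1 := hxl c hc (x d)
    have h2 := hxl d hd (x c)
    rw [hxz d hd] at h1
    rw [hxz c hc] at h2
    have h3 : ‖x c - x d‖ ^ 2 ≤ N (x c - x d) := norm_sq_le_normSqOf_one _
    have h4 : ‖x c - x d‖ ^ 2 ≤ N (x d - x c) := by
      rw [norm_sub_rev]; exact norm_sq_le_normSqOf_one _
    have h5 : inner ℝ ((c : EuclideanSpace ℝ (Fin m)) - d) (φ (x d) - φ (x c))
        ≤ ‖c - d‖ * (L * ‖x c - x d‖) := by
      refine (real_inner_le_norm _ _).trans ?_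
      rw [← Submodule.coe_sub, Submodule.norm_coe, norm_sub_rev (x c)]
      exact mul_le_mul_of_nonneg_left (hL.norm_sub_le (hxz d hd) (hxz c hc)) (norm_nonneg _)
    simp only [inner_sub_left, inner_sub_right, inner_eq_dot, hφ] at h5
    -- Adding the growth inequalities of the minimizers for `c` and `d`, each tested at the other,
    -- cancels the penalties and multipliers and leaves `(c - d) · (f(x₀ + x d) - f(x₀ + x c))` on
    -- the right.
    have h6 : 2 * ε * ‖x c - x d‖ ^ 2 ≤ ‖c - d‖ * (L * ‖x c - x d‖) := by
      nlinarith [mul_le_mul_of_nonneg_left h3 hε.le, mul_le_mul_of_nonneg_left h4 hε.le]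
    have h7 : 2 * ε * ‖x c - x d‖ ≤ L * ‖c - d‖ := by
      rcases (norm_nonneg (x c - x d)).eq_or_lt with h0 | h0
      · rw [← h0, mul_zero]; positivity
      · refine le_of_mul_le_mul_right ?_ h0
        linarith
    have h8 : ((L / (2 * ε.toNNReal) : NNReal) : ℝ) = L / (2 * ε) := by
      rw [NNReal.coe_div, NNReal.coe_mul, NNReal.coe_ofNat, Real.coe_toNNReal _ hε.le]
    rw [h8, div_mul_eq_mul_div, le_div_iff₀ (by positivity)]
    linarith
  obtain ⟨X, hXc, hXz, hXs⟩ := exists_continuousOn_extension hlt (continuous_normSqOf P)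
    (normSqOf_smul P) (fun y hy => normSqOf_pos hpos hy) hz hxLip hxz
  set D : coeffSpace cp → EuclideanSpace ℝ (Fin m) := fun c => φ (X c) - WithLp.toLp 2 p with hD
  have hbase : ∀ u, cp ⬝ᵥ f (x₀ + u) = cp ⬝ᵥ f x₀ + normSqOf P u :=
    dot_quadMap_basePoint_add hA v f0 hpos
  -- `X c` and the combination `p` are at the same level `z` of `c₊ · f`, so the projection in the
  -- field below loses nothing.
  have hDmem : ∀ c ∈ closedBall (0 : coeffSpace cp) 1, D c ∈ coeffSpace cp := by
    intro c hc
    rw [mem_coeffSpace, dotProduct_comm]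
    change cp ⬝ᵥ (f (x₀ + X c) - p) = 0
    rw [dotProduct_sub, hp, dotProduct_add, dotProduct_smul, dotProduct_smul, hbase, hbase, hbase,
      hXz c hc, smul_eq_mul, smul_eq_mul]
    linear_combination -hyz - (cp ⬝ᵥ f x₀) * hab
  have hDc : ContinuousOn D (closedBall 0 1) :=
    (hφc.comp_continuousOn hXc).sub continuousOn_const
  -- On the sphere, the Lagrangian inequalities at `y₁` and `y₂` are averaged with weights `a`, `b`;
  -- the multiplier terms cancel because the average of `|yᵢ|₊²` is `z`, leaving the penalty `εR`.
  -- Subtracting `εR c` absorbs it, so the field points inwards.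
  obtain ⟨c, hc, hc0⟩ := exists_zero_of_inner_nonpos (F := coeffSpace cp)
    (g := fun c => (coeffSpace cp).orthogonalProjectionOnto (D c) - (ε * R) • c)
    (((coeffSpace cp).orthogonalProjectionOnto.continuous.comp_continuousOn hDc).sub
      (continuous_const_smul (ε * R)).continuousOn) (by
    intro c hc
    have hc1 : ‖c‖ = 1 := by simpa using hc
    rw [inner_sub_right, real_inner_smul_right, real_inner_self_eq_norm_sq, hc1, one_pow, mul_one,
      Submodule.inner_orthogonalProjectionOnto_eq_of_mem_left, inner_eq_dot,
      sub_nonpos]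
    change (c : EuclideanSpace ℝ (Fin m)).ofLp ⬝ᵥ (f (x₀ + X c) - p) ≤ ε * R
    rw [dotProduct_sub, hp, dotProduct_add, dotProduct_smul, dotProduct_smul, smul_eq_mul,
      smul_eq_mul, hXs c hc]
    have h1 := mul_le_mul_of_nonneg_left (hxl c hc y₁) ha
    have h2 := mul_le_mul_of_nonneg_left (hxl c hc y₂) hb
    have h3 := mul_nonneg ha (mul_nonneg hε.le (hN0 (y₁ - x c)))
    have h4 := mul_nonneg hb (mul_nonneg hε.le (hN0 (y₂ - x c)))
    have h5 := mul_nonneg hε.le (hN0 (x c))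
    have h6 : l c * z = a * (l c * normSqOf P y₁) + b * (l c * normSqOf P y₂) := by
      rw [← hyz]; ring
    have h7 : ε * R = a * (ε * N y₁) + b * (ε * N y₂) := by rw [hR]; ring
    have h8 : ∀ w : ℝ, w = a * w + b * w := fun w => by rw [← add_mul, hab, one_mul]
    have h9 := h8 ((c : EuclideanSpace ℝ (Fin m)).ofLp ⬝ᵥ f (x₀ + x c) + ε * N (x c) - l c * z)
    linarith)
  refine ⟨X c, hXz c hc, ?_⟩
  change ‖D c‖ ≤ ε * R
  have h1 : (coeffSpace cp).orthogonalProjectionOnto (D c) = (ε * R) • c := sub_eq_zero.1 hc0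
  have h2 : ((coeffSpace cp).orthogonalProjectionOnto (D c) : EuclideanSpace ℝ (Fin m)) = D c :=
    congrArg Subtype.val
      (Submodule.orthogonalProjectionOnto_mem_subspace_eq_self (⟨D c, hDmem c hc⟩ : coeffSpace cp))
  rw [← h2, Submodule.norm_coe, h1, norm_smul, Real.norm_of_nonneg (by positivity)]
  exact mul_le_of_le_one_right (by positivity) (by simpa using hc)

/-- Below `zMax`, a convex combination of two values of `f` is a value of `f` on the corresponding
level set of `|x - x₀|₊ ^ 2`. -/
theorem exists_quadMap_eq_combination {A : Fin m → Matrix (Fin n) (Fin n) 𝕜}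
    (hA : ∀ i, (A i).IsHermitian) (v : Fin m → Fin n → 𝕜) (f0 : Fin m → ℝ) {cp : Fin m → ℝ}
    (hcp : cp ≠ 0) (hpos : (combMat cp A).PosDef)
    (hdim : Module.finrank ℝ (Fin n → 𝕜) + 1 ≠ m) {z : ℝ} (hzmax : ENNReal.ofReal z < zMax A v cp)
    {y₁ y₂ : Fin n → 𝕜} {a b : ℝ} (ha : 0 ≤ a) (hb : 0 ≤ b) (hab : a + b = 1)
    (hyz : a * normSqOf (combMat cp A) y₁ + b * normSqOf (combMat cp A) y₂ = z) :
    ∃ y, normSqOf (combMat cp A) y = z ∧ quadMap A v f0 (basePoint A v cp + y)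
      = a • quadMap A v f0 (basePoint A v cp + y₁) + b • quadMap A v f0 (basePoint A v cp + y₂) := by
  have hq₁ := normSqOf_nonneg hpos y₁
  have hq₂ := normSqOf_nonneg hpos y₂
  have hz0 : 0 ≤ z := by rw [← hyz]; positivity
  -- The extension argument needs `z > 0`; for `z = 0` every point with nonzero weight is the base
  -- point.
  rcases hz0.eq_or_lt with hz | hz
  · have hzero : ∀ (r : ℝ) (y : Fin n → 𝕜), r * normSqOf (combMat cp A) y = 0 → r = 0 ∨ y = 0 := by
      intro r y h
      refine (mul_eq_zero.1 h).imp_right fun h => ?_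
      by_contra hy
      exact (normSqOf_pos hpos hy).ne' h
    have h₁ := hzero a y₁ (by nlinarith [mul_nonneg ha hq₁, mul_nonneg hb hq₂])
    have h₂ := hzero b y₂ (by nlinarith [mul_nonneg ha hq₁, mul_nonneg hb hq₂])
    refine ⟨0, by rw [normSqOf_zero, hz], ?_⟩
    have e₁ : a • quadMap A v f0 (basePoint A v cp + y₁)
        = a • quadMap A v f0 (basePoint A v cp + 0) := by
      rcases h₁ with h | h <;> simp [h]
    have e₂ : b • quadMap A v f0 (basePoint A v cp + y₂)
        = b • quadMap A v f0 (basePoint A v cp + 0) := by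
      rcases h₂ with h | h <;> simp [h]
    rw [e₁, e₂, ← add_smul, hab, one_smul]
  set x₀ := basePoint A v cp with hx₀
  set f := quadMap A v f0 with hf
  set p := a • f (x₀ + y₁) + b • f (x₀ + y₂) with hp
  set φ : (Fin n → 𝕜) → EuclideanSpace ℝ (Fin m) := fun y => WithLp.toLp 2 (f (x₀ + y)) with hφ
  have hlt := finrank_coeffSpace_lt hcp hdim (zero_le.trans_lt hzmax).ne'
  have hS : IsCompact {y : Fin n → 𝕜 | normSqOf (combMat cp A) y = z} :=
    (isCompact_normSqOf_le hpos z).of_isClosed_subset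
      (isClosed_eq (continuous_normSqOf _) continuous_const) fun y hy => le_of_eq hy
  have hφc : Continuous φ := (PiLp.continuous_toLp 2 _).comp
    ((contDiff_quadMap A v f0).continuous.comp (continuous_const.add continuous_id))
  have hmem : WithLp.toLp 2 p ∈ closure (φ '' {y : Fin n → 𝕜 | normSqOf (combMat cp A) y = z}) := by
    rw [Metric.mem_closure_iff]
    intro η hη
    set R := a * normSqOf (1 : Matrix (Fin n) (Fin n) 𝕜) y₁
      + b * normSqOf (1 : Matrix (Fin n) (Fin n) 𝕜) y₂ with hR
    have hsmall : ∀ᶠ ε in 𝓝[>] (0 : ℝ), 0 < ε ∧ ε * R < η := by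
      refine (eventually_mem_nhdsWithin (a := (0 : ℝ)) (s := Set.Ioi 0)).and ?_
      have : Filter.Tendsto (fun ε : ℝ => ε * R) (𝓝[>] 0) (𝓝 (0 * R)) :=
        ((continuous_id.mul continuous_const).tendsto (0 : ℝ)).mono_left nhdsWithin_le_nhds
      rw [zero_mul] at this
      exact this.eventually_lt_const hη
    -- Arbitrarily small admissible `ε` suffice, which is why an upper limit is enough in `zMax`.
    obtain ⟨ε, hε, hε0, hεη⟩ :=
      ((Filter.frequently_lt_of_lt_limsup (by isBoundedDefault) hzmax).and_eventually hsmall).exists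
    have hobj : ∀ c : Fin m → ℝ, c ⬝ᵥ c = 1 → c ⬝ᵥ cp = 0 → z ≤ objective A v cp ε c := by
      intro c hc hc0
      have h1 : ENNReal.ofReal z < ENNReal.ofReal (objective A v cp ε c) :=
        hε.trans_le (iInf₂_le (i := c) ⟨hc, hc0⟩)
      exact (ENNReal.ofReal_lt_ofReal_iff'.1 h1).1.le
    obtain ⟨y, hy, hyd⟩ := exists_dist_quadMap_le hA v f0 hpos hlt hε0 hz hobj ha hb hab hyz
    refine ⟨φ y, ⟨y, hy, rfl⟩, ?_⟩
    rw [dist_comm, dist_eq_norm]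
    exact lt_of_le_of_lt hyd hεη
  rw [(hS.image hφc).isClosed.closure_eq] at hmem
  obtain ⟨y, hy, hyp⟩ := hmem
  exact ⟨y, hy, congrArg WithLp.ofLp hyp⟩

theorem convex_range_of_zMax_eq_top {A : Fin m → Matrix (Fin n) (Fin n) 𝕜}
    (hA : ∀ i, (A i).IsHermitian) (v : Fin m → Fin n → 𝕜) (f0 : Fin m → ℝ) {cp : Fin m → ℝ}
    (hcp : cp ≠ 0) (hpos : (combMat cp A).PosDef)
    (hdim : Module.finrank ℝ (Fin n → 𝕜) + 1 ≠ m) (htop : zMax A v cp = ⊤) :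
    Convex ℝ (Set.range (quadMap A v f0)) := by
  rintro _ ⟨x₁, rfl⟩ _ ⟨x₂, rfl⟩ a b ha hb hab
  obtain ⟨y, -, hy⟩ := exists_quadMap_eq_combination hA v f0 hcp hpos hdim
    (htop ▸ ENNReal.ofReal_lt_top) (y₁ := x₁ - basePoint A v cp) (y₂ := x₂ - basePoint A v cp)
    ha hb hab rfl
  rw [add_sub_cancel, add_sub_cancel] at hy
  exact ⟨_, hy⟩

/-- The part of the image cut out by a finite `zMax`, as the image of a ball. -/
theorem cutImage_eq_image {A : Fin m → Matrix (Fin n) (Fin n) 𝕜} {v : Fin m → Fin n → 𝕜}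
    {f0 : Fin m → ℝ} {cp : Fin m → ℝ} (htop : zMax A v cp ≠ ⊤) :
    cutImage A v f0 cp = (fun y => quadMap A v f0 (basePoint A v cp + y)) ''
      {y | normSqOf (combMat cp A) y ≤ (zMax A v cp).toReal} := by
  ext p
  constructor
  · rintro ⟨x, hx, rfl⟩
    refine ⟨x - basePoint A v cp, ?_, ?_⟩
    · exact (ENNReal.ofReal_le_iff_le_toReal htop).1 hx
    · simp only [add_sub_cancel]
  · rintro ⟨y, hy, rfl⟩
    refine ⟨basePoint A v cp + y, ?_, rfl⟩
    simp only [Set.mem_ofPred_eq, add_sub_cancel_left]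
    exact (ENNReal.ofReal_le_iff_le_toReal htop).2 hy

theorem isCompact_cutImage {A : Fin m → Matrix (Fin n) (Fin n) 𝕜} {v : Fin m → Fin n → 𝕜}
    {f0 : Fin m → ℝ} {cp : Fin m → ℝ} (hpos : (combMat cp A).PosDef) (htop : zMax A v cp ≠ ⊤) :
    IsCompact (cutImage A v f0 cp) := by
  rw [cutImage_eq_image htop]
  exact (isCompact_normSqOf_le hpos _).image
    ((contDiff_quadMap A v f0).continuous.comp (continuous_const.add continuous_id))

theorem cutImage_eq_inter {A : Fin m → Matrix (Fin n) (Fin n) 𝕜} (hA : ∀ i, (A i).IsHermitian)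
    (v : Fin m → Fin n → 𝕜) (f0 : Fin m → ℝ) {cp : Fin m → ℝ} (hpos : (combMat cp A).PosDef)
    (htop : zMax A v cp ≠ ⊤) :
    cutImage A v f0 cp = Set.range (quadMap A v f0) ∩
      {y | cp ⬝ᵥ y ≤ cp ⬝ᵥ quadMap A v f0 (basePoint A v cp) + (zMax A v cp).toReal} := by
  have hbase := dot_quadMap_basePoint_add hA v f0 hpos
  rw [cutImage_eq_image htop]
  ext p
  constructor
  · rintro ⟨y, hy, rfl⟩
    refine ⟨⟨_, rfl⟩, ?_⟩
    simp only [Set.mem_ofPred_eq] at hy ⊢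
    rw [hbase]
    linarith
  · rintro ⟨⟨x, rfl⟩, hx⟩
    have h := hbase (x - basePoint A v cp)
    rw [add_sub_cancel] at h
    refine ⟨x - basePoint A v cp, ?_, by simp only [add_sub_cancel]⟩
    simp only [Set.mem_ofPred_eq] at hx ⊢
    linarith

theorem convex_cutImage_of_zMax_ne_top {A : Fin m → Matrix (Fin n) (Fin n) 𝕜}
    (hA : ∀ i, (A i).IsHermitian) (v : Fin m → Fin n → 𝕜) (f0 : Fin m → ℝ) {cp : Fin m → ℝ}
    (hcp : cp ≠ 0) (hpos : (combMat cp A).PosDef)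
    (hdim : Module.finrank ℝ (Fin n → 𝕜) + 1 ≠ m) (htop : zMax A v cp ≠ ⊤) :
    Convex ℝ (cutImage A v f0 cp) := by
  have hclosed : IsClosed (cutImage A v f0 cp) := (isCompact_cutImage hpos htop).isClosed
  set Z := (zMax A v cp).toReal with hZ
  have hcut := cutImage_eq_image (f0 := f0) htop
  have hfc : Continuous fun y => quadMap A v f0 (basePoint A v cp + y) :=
    (contDiff_quadMap A v f0).continuous.comp (continuous_const.add continuous_id)
  intro p₁ hp₁ p₂ hp₂ a b ha hb hab
  rw [hcut] at hp₁ hp₂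
  obtain ⟨y₁, hy₁, rfl⟩ := hp₁
  obtain ⟨y₂, hy₂, rfl⟩ := hp₂
  have hy₁' : normSqOf (combMat cp A) y₁ ≤ Z := hy₁
  have hy₂' : normSqOf (combMat cp A) y₂ ≤ Z := hy₂
  -- Shrinking yields levels strictly below `Z` only if `Z > 0`; for `Z = 0` the set is one point.
  rcases (ENNReal.toReal_nonneg : 0 ≤ Z).eq_or_lt with hZ0 | hZ0
  · have hzero : ∀ y, normSqOf (combMat cp A) y ≤ Z → y = 0 := by
      intro y hy
      by_contra hne
      linarith [normSqOf_pos hpos hne]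
    rw [hzero y₁ hy₁', hzero y₂ hy₂', hcut]
    refine ⟨0, ?_, ?_⟩
    · simp only [Set.mem_ofPred_eq, normSqOf_zero]
      exact hZ0.le
    · rw [← add_smul, hab, one_smul]
  -- shrink the two points towards the base point and let the factor tend to one
  let p : ℝ → Fin m → ℝ := fun r => a • quadMap A v f0 (basePoint A v cp + r • y₁)
    + b • quadMap A v f0 (basePoint A v cp + r • y₂)
  have hpc : Continuous p :=
    ((hfc.comp (continuous_id.smul continuous_const)).const_smul a).add
      ((hfc.comp (continuous_id.smul continuous_const)).const_smul b)
  have hmem : ∀ r ∈ Set.Ico (0 : ℝ) 1, p r ∈ cutImage A v f0 cp := by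
    intro r hr
    have hr2 : r ^ 2 < 1 := by nlinarith [hr.1, hr.2]
    have hlt : a * normSqOf (combMat cp A) (r • y₁) + b * normSqOf (combMat cp A) (r • y₂) < Z := by
      rw [normSqOf_smul, normSqOf_smul]
      have h1 : a * normSqOf (combMat cp A) y₁ + b * normSqOf (combMat cp A) y₂ ≤ Z := by
        calc _ ≤ a * Z + b * Z := by gcongr
          _ = Z := by rw [← add_mul, hab, one_mul]
      calc a * (r ^ 2 * normSqOf (combMat cp A) y₁) + b * (r ^ 2 * normSqOf (combMat cp A) y₂)
          = r ^ 2 * (a * normSqOf (combMat cp A) y₁ + b * normSqOf (combMat cp A) y₂) := by ring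
        _ ≤ r ^ 2 * Z := by gcongr
        _ < 1 * Z := by gcongr
        _ = Z := one_mul Z
    obtain ⟨y, hy, hyp⟩ := exists_quadMap_eq_combination hA v f0 hcp hpos hdim
      ((ENNReal.ofReal_lt_iff_lt_toReal (by
        have := normSqOf_nonneg hpos (r • y₁)
        have := normSqOf_nonneg hpos (r • y₂)
        positivity) htop).2 hlt) ha hb hab rfl
    rw [hcut]
    exact ⟨y, hy.trans_le hlt.le, hyp⟩
  have hlim : Filter.Tendsto p (𝓝[<] 1) (𝓝 (p 1)) :=
    (hpc.tendsto 1).mono_left nhdsWithin_le_nhds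
  have h1 := hclosed.mem_of_tendsto hlim
    (Filter.mem_of_superset (Ico_mem_nhdsLT zero_lt_one) hmem)
  simpa [p] using h1

end Convexity

end QuadMap

theorem proposition2 {𝕜 : Type*} [RCLike 𝕜] {m n : ℕ}
    (A : Fin m → Matrix (Fin n) (Fin n) 𝕜) (hA : ∀ i, (A i).IsHermitian)
    (v : Fin m → Fin n → 𝕜) (f0 : Fin m → ℝ)
    (cp : Fin m → ℝ) (hcp : cp ≠ 0) (hpos : (QuadMap.combMat cp A).PosDef)
    (hdim : Module.finrank ℝ (Fin n → 𝕜) + 1 ≠ m) :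
    Convex ℝ (QuadMap.cutImage A v f0 cp) ∧
    (QuadMap.zMax A v cp ≠ ⊤ →
      IsCompact (QuadMap.cutImage A v f0 cp) ∧
      QuadMap.cutImage A v f0 cp =
        Set.range (QuadMap.quadMap A v f0) ∩
          {y | cp ⬝ᵥ y ≤ cp ⬝ᵥ QuadMap.quadMap A v f0 (QuadMap.basePoint A v cp)
            + (QuadMap.zMax A v cp).toReal}) ∧
    (QuadMap.zMax A v cp = ⊤ → Convex ℝ (Set.range (QuadMap.quadMap A v f0))) := by
  refine ⟨?_, fun htop => ⟨QuadMap.isCompact_cutImage hpos htop,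
    QuadMap.cutImage_eq_inter hA v f0 hpos htop⟩,
    QuadMap.convex_range_of_zMax_eq_top hA v f0 hcp hpos hdim⟩
  by_cases htop : QuadMap.zMax A v cp = ⊤
  · have h : QuadMap.cutImage A v f0 cp = Set.range (QuadMap.quadMap A v f0) := by
      simp [QuadMap.cutImage, htop]
    rw [h]
    exact QuadMap.convex_range_of_zMax_eq_top hA v f0 hcp hpos hdim htop
  · exact QuadMap.convex_cutImage_of_zMax_ne_top hA v f0 hcp hpos hdim htop
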